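/- Write $M_n=M_n(\mathbb C)$. A linear map $\phi:M_n\to M_n$ is \emph{$q$-positive} if it has no negative eigenvalues and $\phi(I+t\phi)^{-1}$ is completely positive for all $t\ge 0$. For $q$-positive maps $\phi,\psi$ on $M_n$, $\psi$ is a \emph{$q$-subordinate} of $\phi$ if $\phi(I+t\phi)^{-1}-\psi(I+t\psi)^{-1}$ is completely positive for all $t\ge 0$. A $q$-positive map $\phi$ is \emph{$q$-pure} if its set of $q$-subordinates is exactly $\{\phi(I+s\phi)^{-1}: s\ge 0\}\cup\{0\}$. A linear map $\phi$ on $M_n$ is \emph{conjugate} to a linear map $\psi$ on $M_n$ if there is a unitary $U\in M_n$ with $\phi(A)=U^*\psi(UAU^*)U$ for all $A\in M_n$. Theorem. A unital linear map $\phi:M_2(\mathbb C)\to M_2(\mathbb C)$ is $q$-pure if and only if it satisfies one of the following: (i) $\phi(A)=\rho(A)I$ for all $A\in M_2(\mathbb C)$, where $\rho\in M_2(\mathbb C)^*$ is a faithful state; (ii) for some $\lambda\in\mathbb R$, $\phi$ is conjugate to the Schur map $\psi$ defined by $$\psi(A)=\begin{pmatrix} a_{11} & \dfrac{a_{12}}{1+i\lambda}\\[2mm]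 \dfrac{a_{21}}{1-i\lambda} & a_{22}\end{pmatrix}\qquad\text{for all } A=(a_{ij})\in M_2(\mathbb C).$$ In particular, every unital $q$-pure map on $M_2(\mathbb C)$ either has rank one or is invertible. -/

import Mathlib

open scoped ComplexOrder

noncomputable section

namespace QPos

/-- `M_n(ℂ)`. -/
abbrev Mat (n : ℕ) : Type := Matrix (Fin n) (Fin n) ℂ

/-- Linear maps `M_n(ℂ) → M_n(ℂ)`, with composition as multiplication. -/
abbrev Map (n : ℕ) : Type := Module.End ℂ (Mat n)

variable {n : ℕ}

/-- Complete positivity: for every `k`, applying `φ` entrywise to a `k × k` block matrix over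
`M_n(ℂ)` that is positive as a matrix of size `k * n` gives a positive matrix.
(`Matrix.comp` forgets the block structure.) -/
def IsCP (φ : Map n) : Prop :=
  ∀ (k : ℕ) (A : Matrix (Fin k) (Fin k) (Mat n)),
    (Matrix.comp (Fin k) (Fin k) (Fin n) (Fin n) ℂ A).PosSemidef →
      (Matrix.comp (Fin k) (Fin k) (Fin n) (Fin n) ℂ (A.map φ)).PosSemidef

/-- `φ` has no negative (real) eigenvalues. -/
def NoNegEigenvalue (φ : Map n) : Prop :=
  ∀ r : ℝ, r < 0 → ¬ Module.End.HasEigenvalue φ (r : ℂ)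

/-- The map `φ (I + t φ)⁻¹`. For `t ≥ 0` and `φ` without negative eigenvalues, `I + t φ` is
invertible and `Ring.inverse` is its inverse. -/
def resolvent (φ : Map n) (t : ℝ) : Map n :=
  φ * Ring.inverse (1 + (t : ℂ) • φ)

/-- `φ` is `q`-positive. -/
def IsQPositive (φ : Map n) : Prop :=
  NoNegEigenvalue φ ∧ ∀ t : ℝ, 0 ≤ t → IsCP (resolvent φ t)

/-- `φ ≥_q ψ`: both maps are `q`-positive and `φ` `q`-dominates `ψ`,
that is, `ψ` is a `q`-subordinate of `φ`. -/
def QDominates (φ ψ : Map n) : Prop :=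
  IsQPositive φ ∧ IsQPositive ψ ∧
    ∀ t : ℝ, 0 ≤ t → IsCP (resolvent φ t - resolvent ψ t)

/-- `φ` is `q`-pure: it is `q`-positive and its set of `q`-subordinates is
`{φ (I + s φ)⁻¹ : s ≥ 0} ∪ {0}`. -/
def IsQPure (φ : Map n) : Prop :=
  IsQPositive φ ∧
    {ψ : Map n | QDominates φ ψ} = {ψ : Map n | ∃ s : ℝ, 0 ≤ s ∧ ψ = resolvent φ s} ∪ {0}

/-- A state on `M_n(ℂ)`: a positive linear functional with value `1` at the identity. -/
def IsState (ρ : Mat n →ₗ[ℂ] ℂ) : Prop :=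
  (∀ A : Mat n, A.PosSemidef → 0 ≤ ρ A) ∧ ρ 1 = 1

/-- A faithful state: no nonzero positive matrix is annihilated. -/
def IsFaithfulState (ρ : Mat n →ₗ[ℂ] ℂ) : Prop :=
  IsState ρ ∧ ∀ A : Mat n, A.PosSemidef → ρ A = 0 → A = 0

/-- The Schur map `A ↦ M • A` (entrywise product). -/
def schurMap (M : Mat n) : Map n where
  toFun A := Matrix.hadamard M A
  map_add' A B := Matrix.hadamard_add M A B
  map_smul' c A := Matrix.hadamard_smul M A c

/-- `ψ` is conjugate to `φ`: for some unitary `U`, `ψ(A) = U* φ(U A U*) U` for all `A`. -/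
def IsConjugateTo (ψ φ : Map n) : Prop :=
  ∃ U ∈ Matrix.unitaryGroup (Fin n) ℂ,
    ∀ A : Mat n, ψ A = star U * φ (U * A * star U) * U

end QPos

end

noncomputable section

namespace QPos

open Matrix Filter Topology

variable {n : ℕ}

/-! ### The Choi matrix and complete positivity -/

/-! By Choi's theorem (`isCP_iff`) complete positivity is positivity of one matrix. A second tool is
a limit point `L` of `t φ (I + t φ)⁻¹` as `t → ∞` (`IsQPositive.exists_limit`): it is completely
positive, `Lφ = φ = φL` and `ker φ ⊆ ker L`, so it is an idempotent.

A unital `q`-pure map on `M_2` has scalar range or is invertible (`IsQPure.scalar_or_bijective`). If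
its range contains a non-scalar matrix, one may assume that matrix diagonal; then `L` fixes both
diagonal matrix units, hence is a Schur map, and idempotence leaves only the identity, which makes
`φ` invertible, or the projection onto the diagonal. In the latter case `φ` is a stochastic matrix
acting on diagonals, and an explicit subordinate supported in one corner refutes purity
(`not_isQPure_diagMap`).

If `φ = ρ(·)I` is pure, then `ρ` is faithful, since a null density `R` would give the subordinate
`ρ(·)(I - R)`. Conversely, for faithful `ρ` the idempotent of a subordinate is `0` or `φ`, and the
subordinate is then a multiple of `φ` (`isQPure_smulRight_of_faithful`).

If `φ` has inverse `T`, its resolvents are `(T + t)⁻¹`. Expanding them at `t = ∞` shows that `-T`,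
compressed to the complement of the maximally entangled vector, has a positive Choi matrix; so `T =
lyapunov Y - S` with `S` completely positive. The inverse of `lyapunov Y` is a subordinate of `φ`,
and purity forces `S = 0`. As `T` is unital, `Y` is `1/2` plus `i` times a Hermitian matrix, and
diagonalizing it yields the Schur map (`IsQPure.isConjugateTo_phaseMatrix`). Conversely,
subordinates of that Schur map are Schur maps. Reciprocals turn resolvents of multipliers into
translations, and comparing leading terms as `t → ∞` leaves an equality case of AM-GM
(`schur_parameters`). -/

/-- The Choi matrix of a linear map on `M_n(ℂ)`. -/
def choi (φ : Map n) : Matrix (Fin n × Fin n) (Fin n × Fin n) ℂ :=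
  Matrix.comp (Fin n) (Fin n) (Fin n) (Fin n) ℂ (Matrix.of fun i j => φ (Matrix.single i j 1))

lemma choi_apply (φ : Map n) (x y : Fin n × Fin n) :
    choi φ x y = φ (Matrix.single x.1 y.1 1) x.2 y.2 := rfl

lemma map_eq_sum (φ : Map n) (A : Mat n) :
    φ A = ∑ i, ∑ j, A i j • φ (Matrix.single i j 1) := by
  conv_lhs => rw [Matrix.matrix_eq_sum_single A]
  simp only [map_sum]
  refine Finset.sum_congr rfl fun i _ => Finset.sum_congr rfl fun j _ => ?_
  rw [← map_smul, Matrix.smul_single, smul_eq_mul, mul_one]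

lemma map_apply_eq_sum_choi (φ : Map n) (A : Mat n) (k l : Fin n) :
    φ A k l = ∑ i, ∑ j, A i j * choi φ (i, k) (j, l) := by
  rw [map_eq_sum φ A]
  simp [Matrix.sum_apply, choi_apply]

lemma choi_injective : Function.Injective (choi (n := n)) := by
  intro φ ψ h
  refine LinearMap.ext fun A => ?_
  ext k l
  rw [map_apply_eq_sum_choi, map_apply_eq_sum_choi, h]

lemma choi_add (φ ψ : Map n) : choi (φ + ψ) = choi φ + choi ψ := rfl

lemma choi_sub (φ ψ : Map n) : choi (φ - ψ) = choi φ - choi ψ := rfl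

lemma choi_neg (φ : Map n) : choi (-φ) = -choi φ := rfl

lemma choi_smul (c : ℂ) (φ : Map n) : choi (c • φ) = c • choi φ := rfl

lemma choi_zero : choi (0 : Map n) = 0 := rfl

/-- The linear map with a given Choi matrix. -/
def ofChoi (C : Matrix (Fin n × Fin n) (Fin n × Fin n) ℂ) : Map n where
  toFun A := Matrix.of fun k l => ∑ i, ∑ j, A i j * C (i, k) (j, l)
  map_add' A B := by
    ext k l
    simp [add_mul, Finset.sum_add_distrib]
  map_smul' c A := by
    ext k l
    simp [Finset.mul_sum, mul_assoc]

lemma choi_ofChoi (C : Matrix (Fin n × Fin n) (Fin n × Fin n) ℂ) : choi (ofChoi C) = C := by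
  ext x y
  simp only [choi_apply, ofChoi, LinearMap.coe_mk, AddHom.coe_mk, Matrix.of_apply,
    Matrix.single_apply]
  rw [Finset.sum_eq_single x.1 _ (by simp), Finset.sum_eq_single y.1 _ (by simp)]
  · simp
  · intro b _ hb; simp [Ne.symm hb]
  · intro b _ hb; simp [Ne.symm hb]

/-- The block matrix of matrix units is the rank-one positive matrix of the maximally entangled
vector, so complete positivity can be tested on it. -/
lemma IsCP.choi_posSemidef {φ : Map n} (h : IsCP φ) : (choi φ).PosSemidef := by
  have := h n (Matrix.of fun i j => Matrix.single i j 1) (by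
    have : Matrix.comp (Fin n) (Fin n) (Fin n) (Fin n) ℂ
        (Matrix.of fun i j => Matrix.single i j 1) =
        Matrix.vecMulVec (fun x : Fin n × Fin n => if x.1 = x.2 then (1 : ℂ) else 0)
          (star fun x : Fin n × Fin n => if x.1 = x.2 then (1 : ℂ) else 0) := by
      ext x y
      simp only [Matrix.comp_apply, Matrix.of_apply, Matrix.single_apply, Matrix.vecMulVec_apply,
        Pi.star_apply]
      by_cases h1 : x.1 = x.2 <;> by_cases h2 : y.1 = y.2 <;> simp [h1, h2]
    rw [this]
    exact Matrix.posSemidef_vecMulVec_self_star _)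
  exact this

lemma isCP_of_choi_posSemidef {φ : Map n} (h : (choi φ).PosSemidef) : IsCP φ := by
  intro k A hA
  have hk := hA.kronecker h
  -- `W` contracts the inner index of `A` with the input index of the Choi matrix, so the amplified
  -- image is a compression of a Kronecker product of positive matrices.
  let W : Matrix ((Fin k × Fin n) × (Fin n × Fin n)) (Fin k × Fin n) ℂ :=
    Matrix.of fun p q => if p.1.1 = q.1 ∧ p.1.2 = p.2.1 ∧ p.2.2 = q.2 then 1 else 0
  have hW : ∀ p q, W p q = if p.1.1 = q.1 ∧ p.1.2 = p.2.1 ∧ p.2.2 = q.2 then 1 else 0 :=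
    fun _ _ => rfl
  suffices h' : Matrix.comp (Fin k) (Fin k) (Fin n) (Fin n) ℂ (A.map φ) =
      Wᴴ * Matrix.kroneckerMap (fun x y => x * y)
        (Matrix.comp (Fin k) (Fin k) (Fin n) (Fin n) ℂ A) (choi φ) * W by
    rw [h']; exact hk.conjTranspose_mul_mul_same W
  ext ⟨i, p⟩ ⟨j, q⟩
  simp only [Matrix.comp_apply, Matrix.map_apply, map_apply_eq_sum_choi, Matrix.mul_apply,
    Matrix.conjTranspose_apply, hW, Fintype.sum_prod_type, Matrix.kroneckerMap_apply]
  simp [ite_and, apply_ite]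
  rw [Finset.sum_comm]

lemma isCP_iff {φ : Map n} : IsCP φ ↔ (choi φ).PosSemidef :=
  ⟨IsCP.choi_posSemidef, isCP_of_choi_posSemidef⟩

lemma IsCP.zero : IsCP (0 : Map n) := by
  rw [isCP_iff, choi_zero]; exact Matrix.PosSemidef.zero

lemma IsCP.add {φ ψ : Map n} (h : IsCP φ) (h' : IsCP ψ) : IsCP (φ + ψ) := by
  rw [isCP_iff, choi_add]; exact h.choi_posSemidef.add h'.choi_posSemidef

lemma IsCP.smul {φ : Map n} (h : IsCP φ) {c : ℝ} (hc : 0 ≤ c) : IsCP ((c : ℂ) • φ) := by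
  rw [isCP_iff, choi_smul]
  exact h.choi_posSemidef.smul (by exact_mod_cast hc)

lemma IsCP.mul {φ ψ : Map n} (h : IsCP φ) (h' : IsCP ψ) : IsCP (φ * ψ) := by
  intro k A hA
  exact h k _ (h' k A hA)

lemma IsCP.posSemidef {φ : Map n} (h : IsCP φ) {A : Mat n} (hA : A.PosSemidef) :
    (φ A).PosSemidef := by
  have h1 := h 1 (fun _ _ => A) (by
    have := hA.submatrix (Prod.snd : Fin 1 × Fin n → Fin n)
    exact this)
  have := h1.submatrix (fun i : Fin n => ((0 : Fin 1), i))
  exact this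

lemma IsCP.map_star {φ : Map n} (h : IsCP φ) (A : Mat n) : φ (star A) = star (φ A) := by
  have hC := h.choi_posSemidef.isHermitian
  ext k l
  rw [Matrix.star_apply, map_apply_eq_sum_choi, map_apply_eq_sum_choi, Finset.sum_comm]
  simp only [star_sum, star_mul', Matrix.star_apply]
  refine Finset.sum_congr rfl fun i _ => Finset.sum_congr rfl fun j _ => ?_
  rw [← hC.apply (j, k) (i, l)]

lemma _root_.Matrix.PosSemidef.normSq_le {ι : Type*} {M : Matrix ι ι ℂ}
    (h : M.PosSemidef) (i j : ι) : ‖M i j‖ ^ 2 ≤ (M i i).re * (M j j).re := by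
  have h2 := (h.submatrix ![i, j]).det_nonneg
  rw [Matrix.det_fin_two] at h2
  simp only [Matrix.submatrix_apply, Matrix.cons_val_zero, Matrix.cons_val_one] at h2
  have hi := Complex.nonneg_iff.mp (h.diag_nonneg (i := i))
  have hj := Complex.nonneg_iff.mp (h.diag_nonneg (i := j))
  rw [← h.isHermitian.apply j i] at h2
  have := (Complex.nonneg_iff.mp h2).1
  rw [RCLike.star_def, Complex.mul_conj] at this
  simp only [Complex.sub_re, Complex.mul_re, ← hi.2, ← hj.2, Complex.ofReal_re] at this
  rw [Complex.normSq_eq_norm_sq] at this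
  linarith

/-- A positive semidefinite matrix with a zero diagonal entry has a zero row there. -/
lemma _root_.Matrix.PosSemidef.eq_zero_of_diag_left {ι : Type*} {M : Matrix ι ι ℂ}
    (h : M.PosSemidef) {i : ι} (hi : M i i = 0) (j : ι) : M i j = 0 := by
  have := h.normSq_le i j
  rw [hi] at this
  simpa using this

/-- A positive semidefinite matrix with a zero diagonal entry has a zero column there. -/
lemma _root_.Matrix.PosSemidef.eq_zero_of_diag_right {ι : Type*} {M : Matrix ι ι ℂ}
    (h : M.PosSemidef) {j : ι} (hj : M j j = 0) (i : ι) : M i j = 0 := by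
  have := h.normSq_le i j
  rw [hj] at this
  simpa using this

/-- Two-by-two positive semidefiniteness. -/
lemma posSemidef_two {a b : ℝ} {z : ℂ} (ha : 0 ≤ a) (hb : 0 ≤ b) (h : ‖z‖ ^ 2 ≤ a * b) :
    (!![(a : ℂ), z; star z, (b : ℂ)]).PosSemidef := by
  rcases ha.eq_or_lt with rfl | ha
  · have hz : z = 0 := by simpa using h
    subst hz
    have : !![((0 : ℝ) : ℂ), 0; star 0, (b : ℂ)] = Matrix.diagonal ![0, (b : ℂ)] := by
      ext i j; fin_cases i <;> fin_cases j <;> simp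
    rw [this, Matrix.posSemidef_diagonal_iff]
    intro i; fin_cases i <;> simp [hb]
  -- Schur complement: `a` times the matrix is the rank-one square of `(a, star z)` plus `diag(0, ab
  -- - |z|²)`.
  · have h1 := Matrix.posSemidef_vecMulVec_self_star ![(a : ℂ), star z]
    have h2 : (Matrix.diagonal ![(0 : ℂ), ((a * b - ‖z‖ ^ 2 : ℝ) : ℂ)]).PosSemidef := by
      rw [Matrix.posSemidef_diagonal_iff]
      intro i; fin_cases i
      · simp
      · simpa only [Fin.mk_one, Matrix.cons_val_one, Matrix.cons_val_zero,
          Complex.zero_le_real, sub_nonneg] using h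
    have h3 := (h1.add h2).smul (α := ℂ) (a := ((a⁻¹ : ℝ) : ℂ)) (by
      rw [Complex.zero_le_real]; positivity)
    convert h3 using 1
    have ha' : (a : ℂ) ≠ 0 := by exact_mod_cast ha.ne'
    have hz : (starRingEnd ℂ) z * z = ((‖z‖ ^ 2 : ℝ) : ℂ) := by
      rw [mul_comm, Complex.mul_conj, Complex.normSq_eq_norm_sq]
    push_cast at hz
    ext i j
    simp only [Matrix.smul_apply, Matrix.add_apply, Matrix.vecMulVec_apply, Matrix.diagonal_apply]
    fin_cases i <;> fin_cases j <;> simp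
    · simp [ha']
    · simp [ha']
    · field_simp
    · rw [hz]; field_simp; ring

/-! ### Schur maps -/

lemma schurMap_apply (M A : Mat n) (i j : Fin n) : schurMap M A i j = M i j * A i j := rfl

lemma choi_schurMap (M : Mat n) (x y : Fin n × Fin n) :
    choi (schurMap M) x y = if x.1 = x.2 ∧ y.1 = y.2 then M x.1 y.1 else 0 := by
  rw [choi_apply, schurMap_apply, Matrix.single_apply]
  by_cases h1 : x.1 = x.2 <;> by_cases h2 : y.1 = y.2 <;> simp [h1, h2]

lemma isCP_schurMap_iff {M : Mat n} : IsCP (schurMap M) ↔ M.PosSemidef := by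
  rw [isCP_iff]
  constructor
  · intro h
    convert h.submatrix (fun i : Fin n => (i, i)) using 1
    ext i j
    simp [choi_schurMap]
  · intro h
    let W : Matrix (Fin n × Fin n) (Fin n) ℂ :=
      Matrix.of fun p q => if p.1 = q ∧ p.2 = q then 1 else 0
    have hW : ∀ p q, W p q = if p.1 = q ∧ p.2 = q then 1 else 0 := fun _ _ => rfl
    suffices h' : choi (schurMap M) = W * M * Wᴴ by
      rw [h']; exact h.mul_mul_conjTranspose_same W
    ext ⟨i, p⟩ ⟨j, q⟩
    rw [choi_schurMap]
    simp only [Matrix.mul_apply, Matrix.conjTranspose_apply, hW]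
    by_cases h1 : i = p <;> by_cases h2 : j = q <;>
      simp [ite_and, h1, h2, eq_comm, apply_ite]

lemma schurMap_mul (M N : Mat n) : schurMap M * schurMap N = schurMap (M ⊙ N) := by
  refine LinearMap.ext fun A => ?_
  ext i j
  simp [Module.End.mul_apply, schurMap_apply, mul_assoc]

/-- A zero diagonal entry of a positive Choi matrix kills its row and column; only the entries
allowed for a Schur map survive. -/
lemma IsCP.eq_schurMap {φ : Map n} (h : IsCP φ)
    (h0 : ∀ i k, i ≠ k → choi φ (i, k) (i, k) = 0) :
    φ = schurMap (Matrix.of fun i j => φ (Matrix.single i j 1) i j) := by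
  apply choi_injective
  ext ⟨i, p⟩ ⟨j, q⟩
  rw [choi_schurMap]
  by_cases h1 : i = p
  · by_cases h2 : j = q
    · subst h1 h2; simp [choi_apply]
    · rw [h.choi_posSemidef.eq_zero_of_diag_right (h0 _ _ h2)]; simp [h2]
  · rw [h.choi_posSemidef.eq_zero_of_diag_left (h0 _ _ h1)]; simp [h1]

/-! ### Bounds and limits -/

/-- The trace of the Choi matrix is the trace of `φ 1`. -/
lemma IsCP.eq_zero_of_map_one {φ : Map n} (h : IsCP φ) (h1 : φ 1 = 0) : φ = 0 := by
  apply choi_injective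
  rw [choi_zero, ← h.choi_posSemidef.trace_eq_zero_iff, Matrix.trace, Fintype.sum_prod_type,
    Finset.sum_comm]
  refine Finset.sum_eq_zero fun k _ => ?_
  have := map_apply_eq_sum_choi φ 1 k k
  rw [h1] at this
  simpa [Matrix.one_apply] using this.symm

/-- Diagonal Choi entries are nonnegative and sum to diagonal entries of `φ 1`; the `2 × 2` minors
control the rest. This uniform bound supplies the compactness used for limits. -/
lemma IsCP.norm_choi_le {φ : Map n} (h : IsCP φ) {c : ℝ} (hc : 0 ≤ c)
    (h1 : ((c : ℂ) • (1 : Mat n) - φ 1).PosSemidef) (x y : Fin n × Fin n) : ‖choi φ x y‖ ≤ c := by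
  have hd : ∀ x : Fin n × Fin n, (choi φ x x).re ≤ c := by
    rintro ⟨i, k⟩
    have h2 := (Complex.nonneg_iff.mp (h1.diag_nonneg (i := k))).1
    have h3 : φ 1 k k = ∑ i, choi φ (i, k) (i, k) := by
      rw [map_apply_eq_sum_choi]; simp [Matrix.one_apply]
    rw [Matrix.sub_apply, h3] at h2
    simp only [Matrix.smul_apply, Matrix.one_apply_eq, smul_eq_mul, mul_one, Complex.sub_re,
      Complex.ofReal_re, Complex.re_sum] at h2
    have h4 : (choi φ (i, k) (i, k)).re ≤ ∑ i, (choi φ (i, k) (i, k)).re :=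
      Finset.single_le_sum (f := fun i => (choi φ (i, k) (i, k)).re)
        (fun j _ => (Complex.nonneg_iff.mp h.choi_posSemidef.diag_nonneg).1) (Finset.mem_univ i)
    linarith
  have h0 : ∀ x : Fin n × Fin n, 0 ≤ (choi φ x x).re := fun x =>
    (Complex.nonneg_iff.mp h.choi_posSemidef.diag_nonneg).1
  have h2 := h.choi_posSemidef.normSq_le x y
  have h3 : (choi φ x x).re * (choi φ y y).re ≤ c * c :=
    mul_le_mul (hd x) (hd y) (h0 y) hc
  exact abs_le_of_sq_le_sq' (by nlinarith) hc |>.2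

lemma posSemidef_of_tendsto {ι κ : Type*} [Fintype ι] {l : Filter κ} [l.NeBot]
    {f : κ → Matrix ι ι ℂ} {M : Matrix ι ι ℂ} (hf : ∀ᶠ t in l, (f t).PosSemidef)
    (h : ∀ i j, Tendsto (fun t => f t i j) l (𝓝 (M i j))) : M.PosSemidef := by
  apply Matrix.PosSemidef.of_dotProduct_mulVec_nonneg
  · ext i j
    rw [Matrix.conjTranspose_apply]
    refine tendsto_nhds_unique ((continuous_star.tendsto _).comp (h j i)) ((h i j).congr' ?_)
    filter_upwards [hf] with t ht
    exact (ht.isHermitian.apply i j).symm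
  · intro x
    have : Tendsto (fun t => star x ⬝ᵥ (f t *ᵥ x)) l (𝓝 (star x ⬝ᵥ (M *ᵥ x))) := by
      simp only [dotProduct, Matrix.mulVec]
      exact tendsto_finsetSum _ fun i _ => tendsto_const_nhds.mul
        (tendsto_finsetSum _ fun j _ => (h i j).mul tendsto_const_nhds)
    refine ge_of_tendsto this ?_
    filter_upwards [hf] with t ht
    exact ht.dotProduct_mulVec_nonneg x

/-! ### Resolvents -/

lemma NoNegEigenvalue.isUnit {φ : Map n} (h : NoNegEigenvalue φ) {t : ℝ} (ht : 0 ≤ t) :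
    IsUnit (1 + (t : ℂ) • φ) := by
  rcases ht.eq_or_lt with rfl | ht
  · simp
  · have h1 := h (-t⁻¹) (by simpa using ht)
    rw [Module.End.hasEigenvalue_iff_mem_spectrum, spectrum.mem_iff, not_not] at h1
    have ht' : (t : ℂ) ≠ 0 := by exact_mod_cast ht.ne'
    have h2 := h1.smul (Units.mk0 (-(t : ℂ)) (neg_ne_zero.mpr ht'))
    have h3 : Units.mk0 (-(t : ℂ)) (neg_ne_zero.mpr ht') •
        ((algebraMap ℂ (Module.End ℂ (Mat n))) ((-t⁻¹ : ℝ) : ℂ) - φ) = 1 + (t : ℂ) • φ := by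
      rw [Units.smul_mk0, smul_sub, Algebra.algebraMap_eq_smul_one, smul_smul, neg_smul]
      push_cast
      rw [neg_mul_neg, mul_inv_cancel₀ ht', one_smul, sub_neg_eq_add]
    rw [h3] at h2
    exact h2

lemma noNegEigenvalue_of_isUnit {φ : Map n} (h : ∀ t : ℝ, 0 ≤ t → IsUnit (1 + (t : ℂ) • φ)) :
    NoNegEigenvalue φ := by
  intro r hr
  rw [Module.End.hasEigenvalue_iff_mem_spectrum, spectrum.mem_iff, not_not]
  have hr' : (r : ℂ) ≠ 0 := by exact_mod_cast hr.ne
  have h2 := (h (-r⁻¹) (by simpa using hr.le)).smul (Units.mk0 (r : ℂ) hr')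
  have h3 : Units.mk0 (r : ℂ) hr' • (1 + ((-r⁻¹ : ℝ) : ℂ) • φ) =
      (algebraMap ℂ (Module.End ℂ (Mat n))) (r : ℂ) - φ := by
    rw [Units.smul_mk0, smul_add, Algebra.algebraMap_eq_smul_one, smul_smul]
    push_cast
    rw [mul_neg, mul_inv_cancel₀ hr', neg_one_smul, sub_eq_add_neg]
  rw [h3] at h2
  exact h2

lemma IsQPositive.isUnit {φ : Map n} (h : IsQPositive φ) {t : ℝ} (ht : 0 ≤ t) :
    IsUnit (1 + (t : ℂ) • φ) := h.1.isUnit ht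

lemma resolvent_mul {φ : Map n} {t : ℝ} (h : IsUnit (1 + (t : ℂ) • φ)) :
    resolvent φ t * (1 + (t : ℂ) • φ) = φ :=
  Ring.inverse_mul_cancel_right _ _ h

lemma resolvent_eq_of_mul {φ θ : Map n} {t : ℝ} (h : IsUnit (1 + (t : ℂ) • φ))
    (h' : θ * (1 + (t : ℂ) • φ) = φ) : resolvent φ t = θ :=
  ((Ring.eq_mul_inverse_iff_mul_eq _ _ _ h).mpr h').symm

lemma resolvent_eq_inverse_mul {φ : Map n} {t : ℝ} (h : IsUnit (1 + (t : ℂ) • φ)) :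
    resolvent φ t = Ring.inverse (1 + (t : ℂ) • φ) * φ := by
  refine resolvent_eq_of_mul h ?_
  have : φ * (1 + (t : ℂ) • φ) = (1 + (t : ℂ) • φ) * φ := by
    simp [mul_add, add_mul]
  rw [mul_assoc, this, Ring.inverse_mul_cancel_left _ _ h]

lemma mul_resolvent {φ : Map n} {t : ℝ} (h : IsUnit (1 + (t : ℂ) • φ)) :
    (1 + (t : ℂ) • φ) * resolvent φ t = φ := by
  rw [resolvent_eq_inverse_mul h, Ring.mul_inverse_cancel_left _ _ h]

lemma resolvent_zero_right (φ : Map n) : resolvent φ 0 = φ := by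
  simp [resolvent]

lemma resolvent_zero_left (t : ℝ) : resolvent (0 : Map n) t = 0 := by
  simp [resolvent]

lemma resolvent_sub_resolvent {φ : Map n} {s t : ℝ} (hs : IsUnit (1 + (s : ℂ) • φ))
    (ht : IsUnit (1 + (t : ℂ) • φ)) :
    resolvent φ s - resolvent φ t = ((t - s : ℝ) : ℂ) • (resolvent φ s * resolvent φ t) := by
  have h1 : φ * (1 + (t : ℂ) • φ) - (1 + (s : ℂ) • φ) * φ = ((t - s : ℝ) : ℂ) • (φ * φ) := by
    simp only [mul_add, add_mul, mul_one, one_mul, mul_smul_comm, smul_mul_assoc]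
    match_scalars <;> ring
  have h2 := congrArg (fun x => Ring.inverse (1 + (s : ℂ) • φ) * x *
    Ring.inverse (1 + (t : ℂ) • φ)) h1
  simp only [mul_sub, sub_mul, mul_smul_comm, smul_mul_assoc] at h2
  rw [← mul_assoc, Ring.mul_inverse_cancel_right _ _ ht, ← mul_assoc,
    Ring.inverse_mul_cancel _ hs, one_mul] at h2
  rw [resolvent_eq_inverse_mul hs]
  simp only [resolvent]
  rw [h2]
  simp only [mul_assoc]

lemma one_add_smul_resolvent {φ : Map n} {s t : ℝ} (hs : IsUnit (1 + (s : ℂ) • φ)) :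
    1 + (t : ℂ) • resolvent φ s =
      (1 + ((s + t : ℝ) : ℂ) • φ) * Ring.inverse (1 + (s : ℂ) • φ) := by
  rw [Ring.eq_mul_inverse_iff_mul_eq _ _ _ hs, add_mul, smul_mul_assoc, resolvent_mul hs, one_mul]
  push_cast
  rw [add_smul]; abel

lemma IsQPositive.resolvent_resolvent {φ : Map n} (h : IsQPositive φ) {s t : ℝ} (hs : 0 ≤ s)
    (ht : 0 ≤ t) : IsUnit (1 + (t : ℂ) • resolvent φ s) ∧
      resolvent (resolvent φ s) t = resolvent φ (s + t) := by
  have hsu := h.isUnit hs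
  have hu : IsUnit (1 + (t : ℂ) • resolvent φ s) := by
    rw [one_add_smul_resolvent hsu]
    exact (h.isUnit (add_nonneg hs ht)).mul hsu.ringInverse
  refine ⟨hu, resolvent_eq_of_mul hu ?_⟩
  rw [one_add_smul_resolvent hsu, ← mul_assoc, resolvent_mul (h.isUnit (add_nonneg hs ht))]
  rfl

lemma IsQPositive.qDominates_resolvent {φ : Map n} (h : IsQPositive φ) {s : ℝ} (hs : 0 ≤ s) :
    QDominates φ (resolvent φ s) := by
  refine ⟨h, ⟨noNegEigenvalue_of_isUnit fun t ht => (h.resolvent_resolvent hs ht).1,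
    fun t ht => ?_⟩, fun t ht => ?_⟩
  · rw [(h.resolvent_resolvent hs ht).2]
    exact h.2 _ (add_nonneg hs ht)
  · rw [(h.resolvent_resolvent hs ht).2, resolvent_sub_resolvent (h.isUnit ht)
      (h.isUnit (add_nonneg hs ht))]
    exact ((h.2 t ht).mul (h.2 _ (add_nonneg hs ht))).smul (by simpa using hs)

lemma isQPositive_zero : IsQPositive (0 : Map n) := by
  refine ⟨noNegEigenvalue_of_isUnit fun t _ => by simp, fun t _ => ?_⟩
  rw [resolvent_zero_left]
  exact IsCP.zero

/-- Resolvents and zero are always subordinates, by the resolvent identity, so only one inclusion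
has content. -/
lemma isQPure_iff {φ : Map n} : IsQPure φ ↔ IsQPositive φ ∧
    ∀ ψ, QDominates φ ψ → ψ = 0 ∨ ∃ s : ℝ, 0 ≤ s ∧ ψ = resolvent φ s := by
  refine and_congr_right fun h => ⟨fun h' ψ hψ => ?_, fun h' => ?_⟩
  · have : ψ ∈ {ψ : Map n | QDominates φ ψ} := hψ
    rw [h'] at this
    exact this.symm
  · ext ψ
    constructor
    · intro hψ
      exact (h' ψ hψ).symm
    · rintro (⟨s, hs, rfl⟩ | hψ)
      · exact h.qDominates_resolvent hs
      · rw [Set.mem_singleton_iff] at hψ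
        subst hψ
        refine ⟨h, isQPositive_zero, fun t ht => ?_⟩
        rw [resolvent_zero_left, sub_zero]
        exact h.2 t ht

/-- Multiples of idempotents have explicit resolvents. -/
lemma isUnit_and_resolvent_of_mul_self {φ : Map n} {c : ℝ} (hc : 0 ≤ c)
    (h : φ * φ = (c : ℂ) • φ) {t : ℝ} (ht : 0 ≤ t) :
    IsUnit (1 + (t : ℂ) • φ) ∧ resolvent φ t = ((1 / (1 + t * c) : ℝ) : ℂ) • φ := by
  have hp : (0 : ℝ) < 1 + t * c := by positivity
  have hp' : (1 : ℂ) + t * c ≠ 0 := by exact_mod_cast hp.ne'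
  have hu : IsUnit (1 + (t : ℂ) • φ) := by
    refine ⟨⟨1 + (t : ℂ) • φ, 1 - ((t : ℂ) / (1 + t * c)) • φ, ?_, ?_⟩, rfl⟩
    all_goals
      simp only [mul_sub, sub_mul, mul_add, add_mul, mul_one, one_mul, mul_smul_comm,
        smul_mul_assoc, h, smul_smul]
      match_scalars <;> field_simp <;> ring
  refine ⟨hu, resolvent_eq_of_mul hu ?_⟩
  simp only [mul_add, mul_one, mul_smul_comm, smul_mul_assoc, h, smul_smul]
  match_scalars
  field_simp

lemma isQPositive_of_mul_self {φ : Map n} {c : ℝ} (hc : 0 ≤ c)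
    (h : φ * φ = (c : ℂ) • φ) (hφ : IsCP φ) : IsQPositive φ := by
  refine ⟨noNegEigenvalue_of_isUnit fun t ht => (isUnit_and_resolvent_of_mul_self hc h ht).1,
    fun t ht => ?_⟩
  rw [(isUnit_and_resolvent_of_mul_self hc h ht).2]
  exact hφ.smul (by positivity)

/-! ### Invertible maps -/

lemma isUnit_inverse_add_iff {φ T : Map n} (h : φ * T = 1) (h' : T * φ = 1) (t : ℝ) :
    IsUnit (T + (t : ℂ) • 1) ↔ IsUnit (1 + (t : ℂ) • φ) := by
  have hφ : IsUnit φ := ⟨⟨φ, T, h, h'⟩, rfl⟩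
  have : 1 + (t : ℂ) • φ = φ * (T + (t : ℂ) • 1) := by
    rw [mul_add, h, mul_smul_comm, mul_one]
  rw [this]
  exact (hφ.unit.isUnit_units_mul _).symm

lemma resolvent_mul_inverse_add {φ T : Map n} (h : φ * T = 1) (h' : T * φ = 1) {t : ℝ}
    (hu : IsUnit (1 + (t : ℂ) • φ)) :
    resolvent φ t * (T + (t : ℂ) • 1) = 1 ∧ (T + (t : ℂ) • 1) * resolvent φ t = 1 := by
  constructor
  · have h2 := congrArg (· * T) (resolvent_mul hu)
    simp only [mul_assoc, add_mul, one_mul, smul_mul_assoc, h] at h2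
    exact h2
  · have h2 := congrArg (T * ·) (mul_resolvent hu)
    simp only [← mul_assoc, mul_add, mul_one, mul_smul_comm, h'] at h2
    exact h2

/-- For an invertible map with inverse `T` the resolvent at `t` is `(T + t)⁻¹`; it suffices to
produce these inverses and check that they are completely positive. -/
lemma isQPositive_of_inverse {T : Map n} {θ : ℝ → Map n} (hθ : ∀ t, 0 ≤ t → IsCP (θ t))
    (h : ∀ t : ℝ, 0 ≤ t → θ t * (T + (t : ℂ) • 1) = 1)
    (h' : ∀ t : ℝ, 0 ≤ t → (T + (t : ℂ) • 1) * θ t = 1) :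
    IsQPositive (θ 0) ∧ ∀ t, 0 ≤ t → resolvent (θ 0) t = θ t := by
  have h0 : θ 0 * T = 1 := by simpa using h 0 le_rfl
  have h0' : T * θ 0 = 1 := by simpa using h' 0 le_rfl
  have hu : ∀ t : ℝ, 0 ≤ t → IsUnit (1 + (t : ℂ) • θ 0) := fun t ht =>
    (isUnit_inverse_add_iff h0 h0' t).mp ⟨⟨_, θ t, h' t ht, h t ht⟩, rfl⟩
  have hr : ∀ t, 0 ≤ t → resolvent (θ 0) t = θ t := fun t ht => by
    have h1 := (resolvent_mul_inverse_add h0 h0' (hu t ht)).1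
    calc resolvent (θ 0) t = resolvent (θ 0) t * ((T + (t : ℂ) • 1) * θ t) := by
          rw [h' t ht, mul_one]
      _ = θ t := by rw [← mul_assoc, h1, one_mul]
  refine ⟨⟨noNegEigenvalue_of_isUnit hu, fun t ht => ?_⟩, hr⟩
  rw [hr t ht]
  exact hθ t ht

/-! ### Conjugation -/

lemma resolvent_conj (u : (Map n)ˣ) (φ : Map n) (t : ℝ) :
    resolvent (u * φ * u⁻¹ : Map n) t = u * resolvent φ t * u⁻¹ := by
  have h1 : (1 + (t : ℂ) • (u * φ * u⁻¹) : Map n) = u * (1 + (t : ℂ) • φ) * u⁻¹ := by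
    simp only [mul_add, add_mul, mul_one, mul_smul_comm, smul_mul_assoc, Units.mul_inv]
  simp only [resolvent]
  rw [h1, Ring.inverse_mul (Or.inr u⁻¹.isUnit), Ring.inverse_mul (Or.inl u.isUnit),
    Ring.inverse_unit, Ring.inverse_unit]
  simp [mul_assoc]

lemma IsQPositive.conj {u : (Map n)ˣ} (hu : IsCP (u : Map n)) (hu' : IsCP (↑u⁻¹ : Map n))
    {φ : Map n} (h : IsQPositive φ) : IsQPositive (u * φ * u⁻¹ : Map n) := by
  refine ⟨noNegEigenvalue_of_isUnit fun t ht => ?_, fun t ht => ?_⟩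
  · have h1 : (1 + (t : ℂ) • (u * φ * u⁻¹) : Map n) = u * (1 + (t : ℂ) • φ) * u⁻¹ := by
      simp only [mul_add, add_mul, mul_one, mul_smul_comm, smul_mul_assoc, Units.mul_inv]
    rw [h1]
    exact (u.isUnit.mul (h.isUnit ht)).mul u⁻¹.isUnit
  · rw [resolvent_conj]
    exact (hu.mul (h.2 t ht)).mul hu'

lemma QDominates.conj {u : (Map n)ˣ} (hu : IsCP (u : Map n)) (hu' : IsCP (↑u⁻¹ : Map n))
    {φ ψ : Map n} (h : QDominates φ ψ) :
    QDominates (u * φ * u⁻¹ : Map n) (u * ψ * u⁻¹ : Map n) := by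
  refine ⟨h.1.conj hu hu', h.2.1.conj hu hu', fun t ht => ?_⟩
  rw [resolvent_conj, resolvent_conj, ← sub_mul, ← mul_sub]
  exact (hu.mul (h.2.2 t ht)).mul hu'

/-- Conjugation commutes with resolvents, and transports subordinates both ways because `u` and
`u⁻¹` are both completely positive. -/
lemma IsQPure.conj {u : (Map n)ˣ} (hu : IsCP (u : Map n)) (hu' : IsCP (↑u⁻¹ : Map n))
    {φ : Map n} (h : IsQPure φ) : IsQPure (u * φ * u⁻¹ : Map n) := by
  rw [isQPure_iff] at h ⊢
  refine ⟨h.1.conj hu hu', fun ψ hψ => ?_⟩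
  have h1 := hψ.conj (u := u⁻¹) hu' (by simpa using hu)
  have h2 : (↑u⁻¹ * (u * φ * ↑u⁻¹) * ↑(u⁻¹)⁻¹ : Map n) = φ := by simp [mul_assoc]
  rw [h2] at h1
  have h3 : ψ = u * (↑u⁻¹ * ψ * ↑(u⁻¹)⁻¹) * ↑u⁻¹ := by simp [mul_assoc]
  rcases h.2 _ h1 with h0 | ⟨s, hs, h0⟩
  · left; rw [h3, h0]; simp
  · right; exact ⟨s, hs, by rw [resolvent_conj, ← h0, ← h3]⟩

/-- The map `A ↦ V* A V`. -/
def compress (V : Mat n) : Map n where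
  toFun A := star V * A * V
  map_add' A B := by simp [mul_add, add_mul]
  map_smul' c A := by simp

lemma compress_apply (V A : Mat n) : compress V A = star V * A * V := rfl

lemma isCP_compress (V : Mat n) : IsCP (compress V) := by
  rw [isCP_iff]
  convert Matrix.posSemidef_vecMulVec_star_self (fun x : Fin n × Fin n => V x.1 x.2) using 1
  ext x y
  simp [choi_apply, compress_apply, Matrix.vecMulVec_apply, Matrix.mul_apply, Matrix.single_apply,
    ite_and, Matrix.star_apply]

/-- Conjugation by a unitary, as an invertible linear map on `M_n(ℂ)`. -/
def unitaryConj (U : Matrix.unitaryGroup (Fin n) ℂ) : (Map n)ˣ where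
  val := compress (U : Mat n)
  inv := compress (star (U : Mat n))
  val_inv := LinearMap.ext fun A => by
    have h : star (U : Mat n) * U = 1 := Unitary.coe_star_mul_self U
    simp only [Module.End.mul_apply, compress_apply, star_star, Module.End.one_apply]
    calc _ = (star (U : Mat n) * U) * A * (star (U : Mat n) * U) := by simp only [mul_assoc]
      _ = A := by rw [h, one_mul, mul_one]
  inv_val := LinearMap.ext fun A => by
    have h : (U : Mat n) * star (U : Mat n) = 1 := Unitary.coe_mul_star_self U
    simp only [Module.End.mul_apply, compress_apply, star_star, Module.End.one_apply]
    calc _ = ((U : Mat n) * star (U : Mat n)) * A * ((U : Mat n) * star (U : Mat n)) := by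
          simp only [mul_assoc]
      _ = A := by rw [h, one_mul, mul_one]

lemma unitaryConj_apply (U : Matrix.unitaryGroup (Fin n) ℂ) (A : Mat n) :
    (unitaryConj U : Map n) A = star (U : Mat n) * A * U := rfl

lemma unitaryConj_inv_apply (U : Matrix.unitaryGroup (Fin n) ℂ) (A : Mat n) :
    (↑(unitaryConj U)⁻¹ : Map n) A = U * A * star (U : Mat n) := by
  change star (star (U : Mat n)) * A * star (U : Mat n) = _
  rw [star_star]

lemma isCP_unitaryConj (U : Matrix.unitaryGroup (Fin n) ℂ) : IsCP (unitaryConj U : Map n) :=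
  isCP_compress _

lemma isCP_unitaryConj_inv (U : Matrix.unitaryGroup (Fin n) ℂ) :
    IsCP (↑(unitaryConj U)⁻¹ : Map n) :=
  isCP_compress _

lemma isConjugateTo_iff {φ ψ : Map n} : IsConjugateTo φ ψ ↔
    ∃ U : Matrix.unitaryGroup (Fin n) ℂ,
      φ = (unitaryConj U : Map n) * ψ * (↑(unitaryConj U)⁻¹ : Map n) := by
  constructor
  · rintro ⟨U, hU, h⟩
    refine ⟨⟨U, hU⟩, LinearMap.ext fun A => ?_⟩
    rw [h, Module.End.mul_apply, Module.End.mul_apply, unitaryConj_inv_apply, unitaryConj_apply]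
  · rintro ⟨U, rfl⟩
    refine ⟨U, U.2, fun A => ?_⟩
    rw [Module.End.mul_apply, Module.End.mul_apply, unitaryConj_inv_apply, unitaryConj_apply]

lemma unitaryConj_map_one (U : Matrix.unitaryGroup (Fin n) ℂ) {φ : Map n} (h : φ 1 = 1) :
    ((unitaryConj U : Map n) * φ * (↑(unitaryConj U)⁻¹ : Map n)) 1 = 1 := by
  have h1 : (U : Mat n) * star (U : Mat n) = 1 := Unitary.coe_mul_star_self U
  have h2 : star (U : Mat n) * U = 1 := Unitary.coe_star_mul_self U
  simp [Module.End.mul_apply, unitaryConj_inv_apply, unitaryConj_apply, h, h1, h2]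

/-! ### The limit idempotent of a `q`-positive map -/

lemma tendsto_map_apply {κ : Type*} {l : Filter κ} {θ : κ → Map n} {L : Map n}
    (h : ∀ x y, Tendsto (fun k => choi (θ k) x y) l (𝓝 (choi L x y))) (A : Mat n) (i j : Fin n) :
    Tendsto (fun k => θ k A i j) l (𝓝 (L A i j)) := by
  simp only [map_apply_eq_sum_choi]
  exact tendsto_finsetSum _ fun p _ => tendsto_finsetSum _ fun q _ =>
    tendsto_const_nhds.mul (h _ _)

lemma tendsto_apply_map {κ : Type*} {l : Filter κ} {B : κ → Mat n} {C : Mat n}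
    (h : ∀ i j, Tendsto (fun k => B k i j) l (𝓝 (C i j))) (φ : Map n) (i j : Fin n) :
    Tendsto (fun k => φ (B k) i j) l (𝓝 (φ C i j)) := by
  simp only [map_apply_eq_sum_choi φ]
  exact tendsto_finsetSum _ fun p _ => tendsto_finsetSum _ fun q _ =>
    (h _ _).mul tendsto_const_nhds

lemma resolvent_apply_one {φ : Map n} (h : IsQPositive φ) (h1 : φ 1 = 1) {t : ℝ} (ht : 0 ≤ t) :
    resolvent φ t 1 = ((1 / (1 + t) : ℝ) : ℂ) • (1 : Mat n) := by
  have h2 := LinearMap.congr_fun (resolvent_mul (h.isUnit ht)) 1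
  have hp : (1 : ℂ) + t ≠ 0 := by exact_mod_cast (by positivity : (0 : ℝ) < 1 + t).ne'
  have h3 : (1 + (t : ℂ) • φ) 1 = ((1 : ℂ) + t) • (1 : Mat n) := by
    rw [LinearMap.add_apply, LinearMap.smul_apply, h1, Module.End.one_apply, add_smul, one_smul]
  rw [Module.End.mul_apply, h3, map_smul, h1] at h2
  rw [eq_comm]
  nth_rewrite 1 [← h2]
  rw [smul_smul]
  push_cast
  rw [one_div, inv_mul_cancel₀ hp, one_smul]

/-- The limit of `t φ (I + t φ)⁻¹` along some sequence `t → ∞`. -/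
lemma IsQPositive.exists_limit {φ : Map n} (h : IsQPositive φ)
    (h1 : ∀ t : ℝ, 0 ≤ t → (1 - ((t : ℂ) • resolvent φ t) 1).PosSemidef) :
    ∃ L : Map n, IsCP L ∧ L * φ = φ ∧ φ * L = φ ∧ (∀ A, φ A = 0 → L A = 0) ∧
      ∃ s : ℕ → ℝ, (∀ k, 0 ≤ s k) ∧ Tendsto s atTop atTop ∧
        ∀ x y, Tendsto (fun k => choi (((s k : ℝ) : ℂ) • resolvent φ (s k)) x y) atTop
          (𝓝 (choi L x y)) := by
  have hcp : ∀ t : ℝ, 0 ≤ t → IsCP ((t : ℂ) • resolvent φ t) := fun t ht => (h.2 t ht).smul ht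
  -- Integer parameters suffice: the Choi entries lie in a unit ball, so a subsequence converges.
  let f : ℕ → (Fin n × Fin n) → (Fin n × Fin n) → ℂ := fun k x y =>
    choi (((k : ℝ) : ℂ) • resolvent φ (k : ℝ)) x y
  have hf : ∀ k, f k ∈ Metric.closedBall (0 : (Fin n × Fin n) → (Fin n × Fin n) → ℂ) 1 := by
    intro k
    rw [mem_closedBall_zero_iff, pi_norm_le_iff_of_nonneg zero_le_one]
    intro x
    rw [pi_norm_le_iff_of_nonneg zero_le_one]
    intro y
    refine (hcp k k.cast_nonneg).norm_choi_le zero_le_one ?_ x y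
    simpa using h1 k k.cast_nonneg
  obtain ⟨a, -, g, hg, ha⟩ := tendsto_subseq_of_bounded Metric.isBounded_closedBall hf
  have hlim : ∀ x y, Tendsto (fun k => choi (((g k : ℝ) : ℂ) • resolvent φ (g k : ℝ)) x y) atTop
      (𝓝 (choi (ofChoi (Matrix.of a)) x y)) := by
    intro x y
    rw [choi_ofChoi]
    exact (tendsto_pi_nhds.mp ((tendsto_pi_nhds.mp ha) x)) y
  have hs : Tendsto (fun k => (g k : ℝ)) atTop atTop :=
    tendsto_natCast_atTop_atTop.comp hg.tendsto_atTop
  have hinv : Tendsto (fun k => (((g k : ℝ)⁻¹ : ℝ) : ℂ)) atTop (𝓝 0) := by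
    have := (Complex.continuous_ofReal.tendsto 0).comp (tendsto_inv_atTop_zero.comp hs)
    rw [Complex.ofReal_zero] at this
    exact this
  -- The resolvent `R_t` is `t⁻¹` times a convergent sequence, so it vanishes in the limit. Combined
  -- with `φ - R_t = t R_t φ = t φ R_t`, this gives both absorption identities.
  have hres : ∀ A i j, Tendsto (fun k => (φ A - resolvent φ (g k : ℝ) A) i j) atTop
      (𝓝 (φ A i j)) := by
    intro A i j
    have h2 := (hinv.mul (tendsto_map_apply hlim A i j))
    rw [zero_mul] at h2
    have h3 := (tendsto_const_nhds (x := φ A i j)).sub h2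
    rw [sub_zero] at h3
    refine h3.congr' ?_
    filter_upwards [hs.eventually_gt_atTop 0] with k hk
    have hk' : ((g k : ℝ) : ℂ) ≠ 0 := by exact_mod_cast hk.ne'
    rw [Matrix.sub_apply, LinearMap.smul_apply, Matrix.smul_apply, smul_eq_mul, Complex.ofReal_inv,
      inv_mul_cancel_left₀ hk']
  refine ⟨ofChoi (Matrix.of a), ?_, ?_, ?_, ?_, _, fun k => (g k).cast_nonneg, hs, hlim⟩
  · exact isCP_iff.mpr (posSemidef_of_tendsto
      (Eventually.of_forall fun k => (hcp _ (g k).cast_nonneg).choi_posSemidef) hlim)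
  · refine LinearMap.ext fun A => ?_
    ext i j
    refine tendsto_nhds_unique (tendsto_map_apply hlim (φ A) i j) ((hres A i j).congr fun k => ?_)
    have h2 := LinearMap.congr_fun (resolvent_mul (h.isUnit (g k).cast_nonneg)) A
    rw [mul_add, mul_one, mul_smul_comm] at h2
    rw [LinearMap.add_apply] at h2
    rw [sub_eq_of_eq_add' h2.symm]
    rfl
  · refine LinearMap.ext fun A => ?_
    ext i j
    refine tendsto_nhds_unique (tendsto_apply_map (tendsto_map_apply hlim A) φ i j)
      ((hres A i j).congr fun k => ?_)
    have h2 := LinearMap.congr_fun (mul_resolvent (h.isUnit (g k).cast_nonneg)) A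
    rw [add_mul, one_mul, smul_mul_assoc] at h2
    rw [LinearMap.add_apply] at h2
    rw [sub_eq_of_eq_add' h2.symm, LinearMap.smul_apply (f := resolvent φ _), map_smul]
    rfl
  · intro A hA
    ext i j
    refine tendsto_nhds_unique (tendsto_map_apply hlim A i j) (tendsto_const_nhds.congr fun k => ?_)
    rw [resolvent_eq_inverse_mul (h.isUnit (g k).cast_nonneg), LinearMap.smul_apply,
      Module.End.mul_apply, hA, map_zero, smul_zero]

/-- The normalization needed for the existence of the limit holds for every `q`-subordinate of a
unital map. -/
lemma QDominates.one_sub_posSemidef {φ ψ : Map n} (h : QDominates φ ψ) (h1 : φ 1 = 1) {t : ℝ}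
    (ht : 0 ≤ t) : (1 - ((t : ℂ) • resolvent ψ t) 1).PosSemidef := by
  have h2 := ((h.2.2 t ht).smul ht).posSemidef Matrix.PosSemidef.one
  rw [LinearMap.smul_apply, LinearMap.sub_apply, resolvent_apply_one h.1 h1 ht, smul_sub,
    smul_smul] at h2
  have h3 : (((1 / (1 + t) : ℝ) : ℂ) • (1 : Mat n)).PosSemidef :=
    Matrix.PosSemidef.one.smul (by rw [Complex.zero_le_real]; positivity)
  have hp : (1 : ℂ) + t ≠ 0 := by exact_mod_cast (by positivity : (0 : ℝ) < 1 + t).ne'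
  have h4 : (1 : Mat n) - ((t : ℂ) • resolvent ψ t) 1 =
      (((t : ℂ) * ((1 / (1 + t) : ℝ) : ℂ)) • (1 : Mat n) - (t : ℂ) • resolvent ψ t 1) +
        ((1 / (1 + t) : ℝ) : ℂ) • (1 : Mat n) := by
    rw [LinearMap.smul_apply, sub_add_eq_add_sub, ← add_smul]
    congr 1
    push_cast
    rw [← add_one_mul, add_comm, mul_one_div, div_self hp, one_smul]
  rw [h4]
  exact h2.add h3

/-! ### Maps of rank one -/

lemma posSemidef_of_forall_nonneg {ι : Type*} [Fintype ι] [DecidableEq ι] {M : Matrix ι ι ℂ}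
    (h : ∀ x : ι → ℂ, 0 ≤ star x ⬝ᵥ (M *ᵥ x)) : M.PosSemidef := by
  rw [← Matrix.isPositive_toEuclideanLin_iff, LinearMap.isPositive_iff_complex]
  intro x
  have h1 := h x.ofLp
  have h2 : inner ℂ (Matrix.toEuclideanLin M x) x = star (star x.ofLp ⬝ᵥ (M *ᵥ x.ofLp)) := by
    rw [EuclideanSpace.inner_eq_star_dotProduct, Matrix.toLpLin_apply, Matrix.star_dotProduct,
      star_star, dotProduct_comm]
  rw [h2]
  obtain ⟨h3, h4⟩ := Complex.nonneg_iff.mp h1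
  refine ⟨?_, ?_⟩
  · apply Complex.ext <;> simp [← h4]
  · simpa using h3

/-- The Choi matrix is the Kronecker product of the matrix of `ρ` with `B`. -/
lemma isCP_smulRight {ρ : Mat n →ₗ[ℂ] ℂ} (hρ : ∀ A : Mat n, A.PosSemidef → 0 ≤ ρ A) {B : Mat n}
    (hB : B.PosSemidef) : IsCP (ρ.smulRight B) := by
  have h1 : (Matrix.of fun i j => ρ (Matrix.single i j 1) : Mat n).PosSemidef := by
    apply posSemidef_of_forall_nonneg
    intro x
    have h2 := hρ _ (Matrix.posSemidef_vecMulVec_star_self x)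
    convert h2 using 1
    rw [Matrix.matrix_eq_sum_single (vecMulVec (star x) x)]
    simp only [map_sum, dotProduct, Matrix.mulVec, Finset.mul_sum]
    refine Finset.sum_congr rfl fun i _ => Finset.sum_congr rfl fun j _ => ?_
    have : Matrix.single i j (vecMulVec (star x) x i j) =
        (star x i * x j) • Matrix.single i j (1 : ℂ) := by
      rw [Matrix.smul_single, smul_eq_mul, mul_one, Matrix.vecMulVec_apply]
    rw [this, map_smul, Matrix.of_apply, smul_eq_mul]
    ring
  exact isCP_iff.mpr (h1.kronecker hB)

lemma smulRight_mul_self (ρ : Mat n →ₗ[ℂ] ℂ) {B : Mat n} (h : ρ B = 1) :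
    (ρ.smulRight B : Map n) * ρ.smulRight B = ((1 : ℝ) : ℂ) • ρ.smulRight B := by
  refine LinearMap.ext fun A => ?_
  simp [Module.End.mul_apply, h]

lemma isQPure_smulRight_of_faithful {ρ : Mat n →ₗ[ℂ] ℂ} (hρ : IsFaithfulState ρ) :
    IsQPure (ρ.smulRight (1 : Mat n)) := by
  obtain ⟨⟨hpos, hone⟩, hfaith⟩ := hρ
  have hsq := smulRight_mul_self ρ hone
  have hcp := isCP_smulRight hpos (Matrix.PosSemidef.one (n := Fin n) (R := ℂ))
  have happ : ∀ A, ρ.smulRight (1 : Mat n) A = ρ A • (1 : Mat n) := fun A => rfl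
  have hone' : ρ.smulRight (1 : Mat n) 1 = 1 := by rw [happ, hone, one_smul]
  set φ : Map n := ρ.smulRight (1 : Mat n) with hφdef
  have hφ : IsQPositive φ := isQPositive_of_mul_self zero_le_one hsq hcp
  have hres : ∀ t : ℝ, 0 ≤ t → resolvent φ t = ((1 / (1 + t) : ℝ) : ℂ) • φ := fun t ht => by
    simpa using (isUnit_and_resolvent_of_mul_self zero_le_one hsq ht).2
  rw [isQPure_iff]
  refine ⟨hφ, fun ψ hψ => ?_⟩
  obtain ⟨L, hL, hLψ, hψL, hker, s, hs0, hs, hlim⟩ :=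
    hψ.2.1.exists_limit fun t ht => hψ.one_sub_posSemidef hone' ht
  have hLL : ∀ A, L (L A) = L A := by
    intro A
    have h1 : L (L A - A) = 0 := hker _ (by
      rw [map_sub, ← Module.End.mul_apply, hψL, sub_self])
    rwa [map_sub, sub_eq_zero] at h1
  -- Here `t` times the resolvent of `φ` equals `t/(1+t) φ` and tends to `φ`, so domination passes
  -- to the limit.
  have hsub : IsCP (φ - L) := by
    rw [isCP_iff]
    refine posSemidef_of_tendsto (l := atTop)
      (f := fun k => choi (((s k : ℝ) : ℂ) • (resolvent φ (s k) - resolvent ψ (s k))))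
      (Eventually.of_forall fun k => ((hψ.2.2 _ (hs0 k)).smul (hs0 k)).choi_posSemidef)
      fun x y => ?_
    have h1 : Tendsto (fun k => ((1 - 1 / (1 + s k) : ℝ) : ℂ)) atTop (𝓝 1) := by
      have h2 : Tendsto (fun k => 1 - 1 / (1 + s k)) atTop (𝓝 (1 - 0)) :=
        tendsto_const_nhds.sub
          (tendsto_const_nhds.div_atTop (tendsto_atTop_add_const_left _ _ hs))
      have h3 := (Complex.continuous_ofReal.tendsto _).comp h2
      rw [sub_zero, Complex.ofReal_one] at h3
      exact h3
    have h2 := (h1.mul (tendsto_const_nhds (x := choi φ x y))).sub (hlim x y)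
    rw [one_mul] at h2
    rw [choi_sub, Matrix.sub_apply]
    refine h2.congr fun k => ?_
    have hp : (1 : ℂ) + s k ≠ 0 := by
      have := hs0 k
      exact_mod_cast (by positivity : (0 : ℝ) < 1 + s k).ne'
    rw [smul_sub, choi_sub, Matrix.sub_apply, hres _ (hs0 k), smul_smul, choi_smul _ φ,
      Matrix.smul_apply, smul_eq_mul]
    congr 2
    push_cast
    field_simp
    ring
  -- Evaluating `φ - L` at `L 1` gives the positive matrix `ρ(L 1)I - L 1`, on which `ρ` vanishes;
  -- this is where faithfulness enters.
  have hB : L 1 = ρ (L 1) • (1 : Mat n) := by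
    have h1 := hsub.posSemidef (hL.posSemidef Matrix.PosSemidef.one)
    rw [LinearMap.sub_apply, hLL, happ] at h1
    have h2 := hfaith _ h1 (by
      rw [map_sub, map_smul, hone, smul_eq_mul, mul_one, sub_self])
    exact (sub_eq_zero.mp h2).symm
  by_cases hL1 : L 1 = 0
  · left
    rw [← hLψ, hL.eq_zero_of_map_one hL1, zero_mul]
  · have hb : ρ (L 1) = 1 := by
      have h1 := hLL 1
      rw [hB, map_smul, ← hB] at h1
      have h2 : (ρ (L 1) - 1) • L 1 = 0 := by rw [sub_smul, one_smul, h1, sub_self]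
      exact sub_eq_zero.mp ((smul_eq_zero.mp h2).resolve_right hL1)
    rw [hb, one_smul] at hB
    have hLφ : φ = L := sub_eq_zero.mp (hsub.eq_zero_of_map_one (by
      rw [LinearMap.sub_apply, hone', hB, sub_self]))
    have hψφ : ψ = ρ (ψ 1) • φ := by
      refine LinearMap.ext fun A => ?_
      have h1 : ψ A = ρ A • ψ 1 := by
        conv_lhs => rw [← hψL, ← hLφ, Module.End.mul_apply, happ, map_smul]
      have h2 : ψ 1 = ρ (ψ 1) • (1 : Mat n) := by
        conv_lhs => rw [← hLψ, ← hLφ, Module.End.mul_apply, happ]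
      rw [h1, LinearMap.smul_apply, happ]
      conv_lhs => rw [h2]
      rw [smul_comm]
    have hψcp := hψ.2.1.2 0 le_rfl
    have hdcp := hψ.2.2 0 le_rfl
    simp only [resolvent_zero_right] at hψcp hdcp
    obtain ⟨h1, h2⟩ := Complex.nonneg_iff.mp (hpos _ (hψcp.posSemidef Matrix.PosSemidef.one))
    obtain ⟨h3, -⟩ := Complex.nonneg_iff.mp (hpos _ (hdcp.posSemidef Matrix.PosSemidef.one))
    rw [LinearMap.sub_apply, map_sub, hone', hone, Complex.sub_re, Complex.one_re] at h3
    have hc : ρ (ψ 1) = ((ρ (ψ 1)).re : ℂ) := by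
      apply Complex.ext <;> simp [← h2]
    rw [hc] at hψφ
    set c := (ρ (ψ 1)).re
    rcases h1.eq_or_lt with h0 | h0
    · left; rw [hψφ, ← h0]; simp
    -- Now `ψ = cφ` with `0 < c ≤ 1`, and `c = 1/(1+s)` determines `s`.
    · right
      refine ⟨1 / c - 1, ?_, ?_⟩
      · rw [sub_nonneg, le_div_iff₀ h0]; linarith
      · rw [hres _ (by rw [sub_nonneg, le_div_iff₀ h0]; linarith)]
        rw [hψφ]
        congr 2
        field_simp
        ring

/-- A null positive matrix, scaled to a density `R`, gives an idempotent subordinate `ρ(·)(1 - R)`.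
Its value at `1` is nonzero and not scalar, unlike that of any resolvent of `φ`. -/
lemma IsQPure.faithful_of_smulRight {ρ : Mat 2 →ₗ[ℂ] ℂ} (hone : ρ 1 = 1)
    (h : IsQPure (ρ.smulRight (1 : Mat 2))) : IsFaithfulState ρ := by
  have happ : ∀ A, ρ.smulRight (1 : Mat 2) A = ρ A • (1 : Mat 2) := fun A => rfl
  rw [isQPure_iff] at h
  have hcp := h.1.2 0 le_rfl
  rw [resolvent_zero_right] at hcp
  have hpos : ∀ A : Mat 2, A.PosSemidef → 0 ≤ ρ A := fun A hA => by
    have h1 := (hcp.posSemidef hA).diag_nonneg (i := 0)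
    rw [happ] at h1
    simpa using h1
  refine ⟨⟨hpos, hone⟩, fun P hP hP0 => ?_⟩
  by_contra hne
  have htr : P.trace ≠ 0 := fun h0 => hne (hP.trace_eq_zero_iff.mp h0)
  have htr' : 0 ≤ P.trace⁻¹ := by
    have h1 := Complex.nonneg_iff.mp hP.trace_nonneg
    have h2 : P.trace = (P.trace.re : ℂ) := by apply Complex.ext <;> simp [← h1.2]
    rw [h2, ← Complex.ofReal_inv, Complex.zero_le_real]
    exact inv_nonneg.mpr h1.1
  set R : Mat 2 := P.trace⁻¹ • P with hR
  have hRpos : R.PosSemidef := hP.smul htr'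
  have hRtr : R 0 0 + R 1 1 = 1 := by
    rw [← Matrix.trace_fin_two, hR, Matrix.trace_smul, smul_eq_mul, inv_mul_cancel₀ htr]
  have hRρ : ρ R = 0 := by rw [hR, map_smul, hP0, smul_zero]
  -- For a `2 × 2` matrix of trace one, `1 - R` is the adjugate, which is a congruence of the
  -- transpose.
  have hQpos : (1 - R).PosSemidef := by
    have h1 : 1 - R = (!![0, 1; -1, 0] : Mat 2)ᴴ * Rᵀ * !![0, 1; -1, 0] := by
      ext i j
      fin_cases i <;> fin_cases j <;>
        simp [Matrix.mul_apply, Fin.sum_univ_two, Matrix.conjTranspose_apply]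
      · linear_combination -hRtr
      · linear_combination -hRtr
    rw [h1]
    exact hRpos.transpose.conjTranspose_mul_mul_same _
  have hQρ : ρ (1 - R) = 1 := by rw [map_sub, hone, hRρ, sub_zero]
  have hψsq := smulRight_mul_self ρ hQρ
  have hφsq := smulRight_mul_self ρ hone
  have hψ : QDominates (ρ.smulRight (1 : Mat 2)) (ρ.smulRight (1 - R)) := by
    refine ⟨h.1, isQPositive_of_mul_self zero_le_one hψsq (isCP_smulRight hpos hQpos),
      fun t ht => ?_⟩
    rw [(isUnit_and_resolvent_of_mul_self zero_le_one hψsq ht).2,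
      (isUnit_and_resolvent_of_mul_self zero_le_one hφsq ht).2]
    have : ((1 / (1 + t * 1) : ℝ) : ℂ) • ρ.smulRight (1 : Mat 2) -
        ((1 / (1 + t * 1) : ℝ) : ℂ) • ρ.smulRight (1 - R) =
        ((1 / (1 + t * 1) : ℝ) : ℂ) • ρ.smulRight R := by
      refine LinearMap.ext fun A => ?_
      simp [smul_sub]
    rw [this]
    exact (isCP_smulRight hpos hRpos).smul (by positivity)
  rcases h.2 _ hψ with h0 | ⟨s, hs, h0⟩
  · have h1 := congrArg ρ (LinearMap.congr_fun h0 1)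
    simp [hone, hRρ] at h1
  · rw [(isUnit_and_resolvent_of_mul_self zero_le_one hφsq hs).2] at h0
    have h1 := LinearMap.congr_fun h0 1
    rw [LinearMap.smul_apply, happ, LinearMap.smulRight_apply, hone, one_smul, one_smul] at h1
    have h2 := congrArg ρ h1
    rw [hQρ, map_smul, hone, smul_eq_mul, mul_one] at h2
    rw [← h2, one_smul, sub_eq_self] at h1
    rw [h1] at hRtr
    simp at hRtr

/-! ### Purity of the invertible Schur maps -/

lemma schurMap_of_one : schurMap (Matrix.of fun _ _ => 1 : Mat n) = 1 := by
  refine LinearMap.ext fun A => ?_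
  ext i j
  simp [schurMap_apply]

lemma one_add_smul_schurMap (M : Mat n) (c : ℂ) :
    1 + c • schurMap M = schurMap (Matrix.of fun i j => 1 + c * M i j) := by
  refine LinearMap.ext fun A => ?_
  ext i j
  simp only [LinearMap.add_apply, LinearMap.smul_apply, Module.End.one_apply, Matrix.add_apply,
    Matrix.smul_apply, schurMap_apply, Matrix.of_apply, smul_eq_mul]
  ring

lemma isUnit_one_add_smul_schurMap_iff {M : Mat n} {c : ℂ} :
    IsUnit (1 + c • schurMap M) ↔ ∀ i j, 1 + c * M i j ≠ 0 := by
  rw [one_add_smul_schurMap]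
  constructor
  · intro h i j h0
    have hinj := ((Module.End.isUnit_iff _).mp h).1
    have h1 : Matrix.single i j (1 : ℂ) = 0 := by
      apply hinj
      rw [map_zero]
      ext k l
      rw [schurMap_apply, Matrix.single_apply]
      by_cases hkl : i = k ∧ j = l
      · obtain ⟨rfl, rfl⟩ := hkl
        simp [h0]
      · simp [hkl]
    have h2 := congrFun (congrFun h1 i) j
    simp at h2
  · intro h
    refine ⟨⟨schurMap (Matrix.of fun i j => 1 + c * M i j),
      schurMap (Matrix.of fun i j => (1 + c * M i j)⁻¹), ?_, ?_⟩, rfl⟩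
    all_goals
      rw [schurMap_mul, ← schurMap_of_one]
      congr 1
      ext i j
      simp [h i j]

lemma resolvent_schurMap {M : Mat n} {t : ℝ} (h : ∀ i j, 1 + (t : ℂ) * M i j ≠ 0) :
    resolvent (schurMap M) t = schurMap (Matrix.of fun i j => M i j / (1 + t * M i j)) := by
  refine resolvent_eq_of_mul (isUnit_one_add_smul_schurMap_iff.mpr h) ?_
  rw [one_add_smul_schurMap, schurMap_mul]
  congr 1
  ext i j
  simp [h i j]

/-- The Schur multiplier with off-diagonal entries `(1 ± iλ)⁻¹`. -/
def phaseMatrix (l : ℝ) : Mat 2 :=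
  !![1, 1 / (1 + Complex.I * (l : ℂ)); 1 / (1 - Complex.I * (l : ℂ)), 1]

lemma one_add_I_mul_ne_zero (u l : ℝ) (hu : 0 < u) : (u : ℂ) + Complex.I * (l : ℂ) ≠ 0 := by
  intro h
  have := congrArg Complex.re h
  simp at this
  exact hu.ne' this

lemma phaseMatrix_denominator_ne_zero (l : ℝ) {t : ℝ} (ht : 0 ≤ t) (i j : Fin 2) :
    1 + (t : ℂ) * phaseMatrix l i j ≠ 0 := by
  have h1 : (1 : ℂ) + t ≠ 0 := by exact_mod_cast (by positivity : (0 : ℝ) < 1 + t).ne'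
  have h2 := one_add_I_mul_ne_zero 1 l one_pos
  have h3 := one_add_I_mul_ne_zero 1 (-l) one_pos
  have h4 := one_add_I_mul_ne_zero (1 + t) l (by positivity)
  have h5 := one_add_I_mul_ne_zero (1 + t) (-l) (by positivity)
  push_cast at h2 h3 h4 h5
  rw [mul_neg, ← sub_eq_add_neg] at h3 h5
  fin_cases i <;> fin_cases j <;> simp [phaseMatrix]
  · exact h1
  · intro h
    apply h4
    field_simp at h
    linear_combination h
  · intro h
    apply h5
    field_simp at h
    linear_combination h
  · exact h1

lemma resolvent_phaseMatrix (l : ℝ) {t : ℝ} (ht : 0 ≤ t) :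
    resolvent (schurMap (phaseMatrix l)) t =
      schurMap !![((1 / (1 + t) : ℝ) : ℂ), 1 / (((1 + t : ℝ) : ℂ) + Complex.I * l);
        star (1 / (((1 + t : ℝ) : ℂ) + Complex.I * l)), ((1 / (1 + t) : ℝ) : ℂ)] := by
  rw [resolvent_schurMap (phaseMatrix_denominator_ne_zero l ht)]
  congr 1
  have h2 := one_add_I_mul_ne_zero 1 l one_pos
  have h3 := one_add_I_mul_ne_zero 1 (-l) one_pos
  have h4 := one_add_I_mul_ne_zero (1 + t) l (by positivity)
  have h5 := one_add_I_mul_ne_zero (1 + t) (-l) (by positivity)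
  have h6 := phaseMatrix_denominator_ne_zero l ht 0 1
  have h7 := phaseMatrix_denominator_ne_zero l ht 1 0
  push_cast at h2 h3 h4 h5
  rw [mul_neg, ← sub_eq_add_neg] at h3 h5
  simp only [phaseMatrix, Matrix.of_apply, Matrix.cons_val_zero, Matrix.cons_val_one,
    Matrix.cons_val', Matrix.cons_val_fin_one] at h6 h7
  ext i j
  fin_cases i <;> fin_cases j <;> simp [phaseMatrix]
  · rw [← one_div, ← one_div, div_eq_div_iff (by simpa using h6) h4]
    field_simp
    ring
  · rw [← sub_eq_add_neg, ← one_div, ← one_div, div_eq_div_iff (by simpa using h7) h5]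
    field_simp
    ring

lemma norm_sq_one_div_add_I_mul (u l : ℝ) :
    ‖1 / ((u : ℂ) + Complex.I * l)‖ ^ 2 = 1 / (u ^ 2 + l ^ 2) := by
  rw [norm_div, div_pow, norm_one, one_pow, ← Complex.normSq_eq_norm_sq, mul_comm Complex.I,
    Complex.normSq_add_mul_I]

lemma isQPositive_phaseMatrix (l : ℝ) : IsQPositive (schurMap (phaseMatrix l)) := by
  refine ⟨noNegEigenvalue_of_isUnit fun t ht =>
    isUnit_one_add_smul_schurMap_iff.mpr (phaseMatrix_denominator_ne_zero l ht), fun t ht => ?_⟩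
  rw [resolvent_phaseMatrix l ht, isCP_schurMap_iff]
  refine posSemidef_two (by positivity) (by positivity) ?_
  rw [norm_sq_one_div_add_I_mul, div_mul_div_comm, one_mul, ← sq]
  exact one_div_le_one_div_of_le (by positivity) (by nlinarith [sq_nonneg l])

/-- Letting the resolvent parameter tend to infinity. -/
lemma add_le_of_forall_le {a b x y l : ℝ}
    (h : ∀ u : ℝ, 1 ≤ u → (u + a) * (u + b) ≤ (u + x) ^ 2 + (l + y) ^ 2) : a + b ≤ 2 * x := by
  have h1 : Tendsto (fun v : ℝ => a + b + a * b * v) (𝓝[>] 0) (𝓝 (a + b + a * b * 0)) :=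
    (Continuous.tendsto (by fun_prop) 0).mono_left nhdsWithin_le_nhds
  have h2 : Tendsto (fun v : ℝ => 2 * x + (x ^ 2 + (l + y) ^ 2) * v) (𝓝[>] 0)
      (𝓝 (2 * x + (x ^ 2 + (l + y) ^ 2) * 0)) :=
    (Continuous.tendsto (by fun_prop) 0).mono_left nhdsWithin_le_nhds
  have h3 := le_of_tendsto_of_tendsto h1 h2 (by
    filter_upwards [Ioc_mem_nhdsGT (zero_lt_one' ℝ)] with v hv
    have h4 := h (1 / v) (by rw [le_div_iff₀ hv.1]; linarith [hv.2])
    have h5 := mul_le_mul_of_nonneg_right h4 hv.1.le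
    have hv0 : v ≠ 0 := hv.1.ne'
    have h6 : (1 / v + a) * (1 / v + b) * v = 1 / v + (a + b + a * b * v) := by
      field_simp; ring
    have h7 : ((1 / v + x) ^ 2 + (l + y) ^ 2) * v =
        1 / v + (2 * x + (x ^ 2 + (l + y) ^ 2) * v) := by
      field_simp; ring
    rw [h6, h7] at h5
    linarith)
  simpa using h3

/-- Compare the coefficients of `u⁴`, substituting `u = 1/v` and letting `v → 0⁺`. -/
lemma le_mul_of_forall_le {a b c x y l : ℝ}
    (h : ∀ u : ℝ, 1 ≤ u → c * (u ^ 2 * ((u + a) * (u + b))) ≤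
      a * b * ((u ^ 2 + l ^ 2) * ((u + x) ^ 2 + (l + y) ^ 2))) : c ≤ a * b := by
  have h1 : Tendsto (fun v : ℝ => c * ((1 + a * v) * (1 + b * v))) (𝓝[>] 0)
      (𝓝 (c * ((1 + a * 0) * (1 + b * 0)))) :=
    (Continuous.tendsto (by fun_prop) 0).mono_left nhdsWithin_le_nhds
  have h2 : Tendsto (fun v : ℝ => a * b * ((1 + l ^ 2 * v ^ 2) *
      ((1 + x * v) ^ 2 + (l + y) ^ 2 * v ^ 2))) (𝓝[>] 0)
      (𝓝 (a * b * ((1 + l ^ 2 * 0 ^ 2) * ((1 + x * 0) ^ 2 + (l + y) ^ 2 * 0 ^ 2)))) :=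
    (Continuous.tendsto (f := fun v : ℝ => a * b * ((1 + l ^ 2 * v ^ 2) *
      ((1 + x * v) ^ 2 + (l + y) ^ 2 * v ^ 2))) (by fun_prop) 0).mono_left nhdsWithin_le_nhds
  have h3 := le_of_tendsto_of_tendsto h1 h2 (by
    filter_upwards [Ioc_mem_nhdsGT (zero_lt_one' ℝ)] with v hv
    have h4 := h (1 / v) (by rw [le_div_iff₀ hv.1]; linarith [hv.2])
    have h5 := mul_le_mul_of_nonneg_right h4 (by have := hv.1; positivity : (0 : ℝ) ≤ v ^ 4)
    have hv0 : v ≠ 0 := hv.1.ne'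
    convert h5 using 1 <;> field_simp)
  simpa using h3

/-- For `r > 0` the right side is `(1-r)/((1+t)²(1+tr))`, which decays faster than the left. The
choice `t = l²/r` already gives a contradiction, since then `r(1+t) = r + l²` would be at most `l²`.
-/
lemma eq_zero_of_resolvent_le {r l : ℝ} (hr : 0 ≤ r)
    (h : ∀ t : ℝ, 0 ≤ t →
      1 / ((1 + t) ^ 2 + l ^ 2) ≤ 1 / (1 + t) * (1 / (1 + t) - r / (1 + t * r))) : r = 0 := by
  by_contra hne
  have hr0 : 0 < r := lt_of_le_of_ne hr (Ne.symm hne)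
  have ht : 0 ≤ l ^ 2 / r := by positivity
  have h1 := h _ ht
  set t := l ^ 2 / r
  have hl : r * t = l ^ 2 := mul_div_cancel₀ _ hr0.ne'
  have h2 : 1 / (1 + t) * (1 / (1 + t) - r / (1 + t * r)) =
      (1 - r) / ((1 + t) ^ 2 * (1 + t * r)) := by
    field_simp; ring
  rw [h2, div_le_div_iff₀ (by positivity) (by positivity), one_mul] at h1
  have h3 : r * (1 + t) ^ 3 ≤ (1 - r) * l ^ 2 := by nlinarith
  have h4 : r * (1 + t) ≤ r * (1 + t) ^ 3 :=
    mul_le_mul_of_nonneg_left (le_self_pow₀ (by linarith) (by norm_num)) hr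
  have h5 : (1 - r) * l ^ 2 ≤ l ^ 2 := by nlinarith [mul_nonneg hr (sq_nonneg l)]
  nlinarith

lemma resolvent_one_div {p : ℝ} (hp : 0 < p) (t : ℝ) :
    p / (1 + t * p) = 1 / (1 + t + (1 / p - 1)) := by
  have : 1 + t + (1 / p - 1) = (1 + t * p) / p := by field_simp; ring
  rw [this, one_div_div]

lemma one_div_sub_resolvent {p : ℝ} (hp : 0 < p) (hp1 : p ≤ 1) {t : ℝ} (ht : 0 ≤ t) :
    1 / (1 + t) - p / (1 + t * p) = (1 / p - 1) / ((1 + t) * (1 + t + (1 / p - 1))) := by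
  have h0 : 0 ≤ 1 / p - 1 := by rw [sub_nonneg, le_div_iff₀ hp]; linarith
  have h1 : 1 + t + (1 / p - 1) ≠ 0 := by positivity
  have h2 : (1 + t) ≠ 0 := by positivity
  rw [resolvent_one_div hp t, div_sub_div _ _ h2 h1]
  congr 1
  ring

/-- With `u = 1 + t`, the left side has order `u⁻²` and the right side at most `u⁻⁴`. The chosen `k`
makes `αβ(u² + l²) ≤ k u² < u³` at `t = k`. -/
lemma not_forall_one_div_le_resolvent {α β l : ℝ} (hα : 0 ≤ α) (hβ : 0 ≤ β) :
    ¬ ∀ t : ℝ, 0 ≤ t → 1 / ((1 + t) ^ 2 + l ^ 2) ≤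
      α / ((1 + t) * (1 + t + α)) * (β / ((1 + t) * (1 + t + β))) := by
  intro h
  obtain ⟨k, hkd⟩ : ∃ k : ℝ, k = α * β * (1 + l ^ 2) := ⟨_, rfl⟩
  have hk : 0 ≤ k := by rw [hkd]; positivity
  have h1 := h k hk
  obtain ⟨u, hu⟩ : ∃ u : ℝ, u = 1 + k := ⟨_, rfl⟩
  rw [← hu] at h1
  have hu1 : 1 ≤ u := by linarith
  have hu0 : 0 < u := by linarith
  rw [div_mul_div_comm, div_le_div_iff₀ (by positivity) (by positivity), one_mul] at h1
  have h2 : u ^ 4 ≤ u * (u + α) * (u * (u + β)) := by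
    have h2 : u * (u + α) * (u * (u + β)) - u ^ 4 = u ^ 2 * (u * α + u * β + α * β) := by ring
    have h3 : 0 ≤ u ^ 2 * (u * α + u * β + α * β) := by positivity
    linarith
  have h3 : α * β * (u ^ 2 + l ^ 2) ≤ k * u ^ 2 := by
    have h4 : l ^ 2 ≤ l ^ 2 * u ^ 2 := le_mul_of_one_le_right (sq_nonneg l) (one_le_pow₀ hu1)
    have h5 : α * β * (u ^ 2 + l ^ 2) ≤ α * β * (u ^ 2 + l ^ 2 * u ^ 2) :=
      mul_le_mul_of_nonneg_left (by linarith) (mul_nonneg hα hβ)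
    have h6 : k * u ^ 2 = α * β * (u ^ 2 + l ^ 2 * u ^ 2) := by rw [hkd]; ring
    linarith
  have h5 : k * u ^ 2 < u * u ^ 2 := mul_lt_mul_of_pos_right (by linarith) (by positivity)
  have h6 : u * u ^ 2 ≤ u ^ 4 := by
    have h7 : u ^ 4 = u * (u * u ^ 2) := by ring
    rw [h7]; exact le_mul_of_one_le_left (by positivity) hu1
  linarith

lemma eq_of_add_le_of_sq_le {α β x y : ℝ} (hα : 0 ≤ α) (hβ : 0 ≤ β) (hA : α + β ≤ 2 * x)
    (hB : x ^ 2 + y ^ 2 ≤ α * β) : α = β ∧ x = α ∧ y = 0 := by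
  have hsq : (α + β) ^ 2 ≤ (2 * x) ^ 2 := pow_le_pow_left₀ (by positivity) hA 2
  have h1 : (α - β) ^ 2 ≤ 0 := by linarith [sq_nonneg y, sq_nonneg (α - β)]
  have hαβ : α = β := by
    have := pow_eq_zero_iff (two_ne_zero) |>.mp (le_antisymm h1 (sq_nonneg _))
    linarith
  have hy : y ^ 2 ≤ 0 := by linarith [sq_nonneg (α - β)]
  subst hαβ
  refine ⟨rfl, ?_, by simpa using le_antisymm hy (sq_nonneg _)⟩
  have h2 : x ≤ α := abs_le_of_sq_le_sq' (by nlinarith [sq_nonneg y]) hα |>.2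
  linarith

/-- Comparison of the resolvents of two `2 × 2` Schur multipliers. -/
lemma schur_parameters {p r l : ℝ} {w : ℂ} (hp : 0 ≤ p) (hr : 0 ≤ r) (hp1 : p ≤ 1) (hr1 : r ≤ 1)
    (hw : ∀ t : ℝ, 0 ≤ t → 1 + (t : ℂ) * w ≠ 0)
    (ha : ∀ t : ℝ, 0 ≤ t → ‖w / (1 + t * w)‖ ^ 2 ≤ p / (1 + t * p) * (r / (1 + t * r)))
    (hb : ∀ t : ℝ, 0 ≤ t → ‖1 / (((1 + t : ℝ) : ℂ) + Complex.I * l) - w / (1 + t * w)‖ ^ 2 ≤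
      (1 / (1 + t) - p / (1 + t * p)) * (1 / (1 + t) - r / (1 + t * r))) :
    (p = 0 ∧ r = 0 ∧ w = 0) ∨
      ∃ s : ℝ, 0 ≤ s ∧ p = 1 / (1 + s) ∧ r = 1 / (1 + s) ∧
        w = 1 / (((1 + s : ℝ) : ℂ) + Complex.I * l) := by
  have ha0 : ‖w‖ ^ 2 ≤ p * r := by simpa using ha 0 le_rfl
  have hb0 : w = 0 → ∀ t : ℝ, 0 ≤ t → 1 / ((1 + t) ^ 2 + l ^ 2) ≤
      (1 / (1 + t) - p / (1 + t * p)) * (1 / (1 + t) - r / (1 + t * r)) := fun h0 t ht => by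
    have h1 := hb t ht
    rwa [h0, zero_div, sub_zero, norm_sq_one_div_add_I_mul] at h1
  rcases hp.eq_or_lt with hp0 | hp0
  · left
    subst hp0
    have hw0 : w = 0 := by simpa using ha0
    refine ⟨rfl, eq_zero_of_resolvent_le (l := l) hr fun t ht => ?_, hw0⟩
    simpa using hb0 hw0 t ht
  rcases hr.eq_or_lt with hr0 | hr0
  · left
    subst hr0
    have hw0 : w = 0 := by simpa using ha0
    refine ⟨eq_zero_of_resolvent_le (l := l) hp fun t ht => ?_, rfl, hw0⟩
    have := hb0 hw0 t ht
    rw [mul_comm]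
    simpa using this
  right
  have hα : 0 ≤ 1 / p - 1 := by rw [sub_nonneg, le_div_iff₀ hp0]; linarith
  have hβ : 0 ≤ 1 / r - 1 := by rw [sub_nonneg, le_div_iff₀ hr0]; linarith
  by_cases hw0 : w = 0
  · exfalso
    refine not_forall_one_div_le_resolvent (l := l) hα hβ fun t ht => ?_
    have h1 := hb0 hw0 t ht
    rwa [one_div_sub_resolvent hp0 hp1 ht, one_div_sub_resolvent hr0 hr1 ht] at h1
  -- The reciprocal of `w/(1+tw)` is `1/w + t`, so `z` is the `t`-independent shift between the
  -- reciprocal off-diagonal entries; `1/p - 1` and `1/r - 1` are the diagonal shifts. Positivity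
  -- will give `1/p - 1 + (1/r - 1) ≤ 2 Re z`, domination `|z|² ≤ (1/p - 1)(1/r - 1)`.
  · obtain ⟨z, hz⟩ : ∃ z : ℂ, z = 1 / w - 1 - Complex.I * l := ⟨_, rfl⟩
    have hwt : ∀ t : ℝ, 0 ≤ t → w / (1 + t * w) =
        1 / (((1 + t + z.re : ℝ) : ℂ) + Complex.I * ((l + z.im : ℝ) : ℂ)) := by
      intro t ht
      have h1 := hw t ht
      have h2 : (((1 + t + z.re : ℝ) : ℂ) + Complex.I * ((l + z.im : ℝ) : ℂ)) =
          1 + t + Complex.I * l + z := by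
        push_cast
        linear_combination Complex.re_add_im z
      rw [h2, hz]
      have h3 : (1 : ℂ) + t + Complex.I * l + (1 / w - 1 - Complex.I * l) = (1 + t * w) / w := by
        field_simp; ring
      rw [h3, one_div_div]
    have hden : ∀ t : ℝ, 0 ≤ t →
        (((1 + t + z.re : ℝ) : ℂ) + Complex.I * ((l + z.im : ℝ) : ℂ)) ≠ 0 := by
      intro t ht h0
      have h1 := hwt t ht
      rw [h0, div_zero, div_eq_zero_iff] at h1
      exact h1.elim hw0 (hw t ht)
    have hnorm : ∀ t : ℝ, 0 ≤ t → 0 < (1 + t + z.re) ^ 2 + (l + z.im) ^ 2 := by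
      intro t ht
      have h2 : 0 < Complex.normSq (((1 + t + z.re : ℝ) : ℂ) + Complex.I * ((l + z.im : ℝ) : ℂ)) :=
        Complex.normSq_pos.mpr (hden t ht)
      rwa [mul_comm Complex.I, Complex.normSq_add_mul_I] at h2
    have hA : 1 / p - 1 + (1 / r - 1) ≤ 2 * z.re := by
      refine add_le_of_forall_le (y := z.im) (l := l) fun u hu => ?_
      have ht : 0 ≤ u - 1 := by linarith
      have h1 := ha _ ht
      rw [hwt _ ht, norm_sq_one_div_add_I_mul, resolvent_one_div hp0, resolvent_one_div hr0,
        div_mul_div_comm, one_mul, add_sub_cancel] at h1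
      have h2 := hnorm _ ht
      rw [add_sub_cancel] at h2
      exact (one_div_le_one_div h2 (by positivity)).mp h1
    have hB : z.re ^ 2 + z.im ^ 2 ≤ (1 / p - 1) * (1 / r - 1) := by
      refine le_mul_of_forall_le (x := z.re) (y := z.im) (l := l) fun u hu => ?_
      have ht : 0 ≤ u - 1 := by linarith
      have h1 := hb _ ht
      have h2 := hnorm _ ht
      have h3 := hden _ ht
      rw [hwt _ ht, one_div_sub_resolvent hp0 hp1 ht, one_div_sub_resolvent hr0 hr1 ht] at h1
      rw [add_sub_cancel] at h1 h2 h3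
      have h4 := one_add_I_mul_ne_zero u l (by linarith)
      have h5 : 1 / ((u : ℂ) + Complex.I * l) -
          1 / (((u + z.re : ℝ) : ℂ) + Complex.I * ((l + z.im : ℝ) : ℂ)) =
          z * ((1 / ((u : ℂ) + Complex.I * l)) *
            (1 / (((u + z.re : ℝ) : ℂ) + Complex.I * ((l + z.im : ℝ) : ℂ)))) := by
        have h6 : (((u + z.re : ℝ) : ℂ) + Complex.I * ((l + z.im : ℝ) : ℂ)) =
            ((u : ℂ) + Complex.I * l) + z := by
          push_cast
          linear_combination Complex.re_add_im z
        rw [h6] at h3 ⊢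
        field_simp
        ring
      rw [h5, norm_mul, norm_mul, mul_pow, mul_pow, norm_sq_one_div_add_I_mul,
        norm_sq_one_div_add_I_mul, ← Complex.normSq_eq_norm_sq, Complex.normSq_apply,
        div_mul_div_comm, div_mul_div_comm, one_mul, mul_one_div,
        div_le_div_iff₀ (by positivity) (by positivity)] at h1
      linarith
    set α := 1 / p - 1 with hαd
    set β := 1 / r - 1 with hβd
    obtain ⟨hαβ, hre, him⟩ := eq_of_add_le_of_sq_le hα hβ hA hB
    have hp2 : p = 1 / (1 + α) := by rw [hαd]; simp
    have hr2 : r = 1 / (1 + α) := by rw [hαβ, hβd]; simp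
    refine ⟨α, hα, hp2, hr2, ?_⟩
    have h1 := hwt 0 le_rfl
    rw [him, hre] at h1
    simpa using h1

lemma isQPure_phaseMatrix (l : ℝ) : IsQPure (schurMap (phaseMatrix l)) := by
  rw [isQPure_iff]
  refine ⟨isQPositive_phaseMatrix l, fun ψ hψ => ?_⟩
  have hcp := hψ.2.1.2 0 le_rfl
  have hdcp := hψ.2.2 0 le_rfl
  simp only [resolvent_zero_right] at hcp hdcp
  -- The Choi matrix of `ψ` lies between zero and that of a Schur map, so the relevant diagonal
  -- entries vanish.
  have hS := hcp.eq_schurMap (fun i k hik => by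
    have h1 := hcp.choi_posSemidef.diag_nonneg (i := (i, k))
    have h2 := hdcp.choi_posSemidef.diag_nonneg (i := (i, k))
    rw [choi_sub, Matrix.sub_apply, choi_schurMap, if_neg (by simp [hik]), zero_sub] at h2
    exact le_antisymm (neg_nonneg.mp h2) h1)
  set N : Mat 2 := Matrix.of fun i j => ψ (Matrix.single i j 1) i j with hN
  rw [hS, isCP_schurMap_iff] at hcp
  obtain ⟨hp, hpi⟩ := Complex.nonneg_iff.mp (hcp.diag_nonneg (i := 0))
  obtain ⟨hr, hri⟩ := Complex.nonneg_iff.mp (hcp.diag_nonneg (i := 1))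
  have hpN : N 0 0 = ((N 0 0).re : ℂ) := by apply Complex.ext <;> simp [← hpi]
  have hrN : N 1 1 = ((N 1 1).re : ℂ) := by apply Complex.ext <;> simp [← hri]
  have hden : ∀ t : ℝ, 0 ≤ t → ∀ i j, 1 + (t : ℂ) * N i j ≠ 0 := fun t ht => by
    have h1 := hψ.2.1.isUnit ht
    rw [hS] at h1
    exact isUnit_one_add_smul_schurMap_iff.mp h1
  have hψt : ∀ t : ℝ, 0 ≤ t → (Matrix.of fun i j => N i j / (1 + t * N i j) : Mat 2).PosSemidef :=
    fun t ht => by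
      have h1 := hψ.2.1.2 t ht
      rwa [hS, resolvent_schurMap (hden t ht), isCP_schurMap_iff] at h1
  have hdt : ∀ t : ℝ, 0 ≤ t →
      (!![((1 / (1 + t) : ℝ) : ℂ), 1 / (((1 + t : ℝ) : ℂ) + Complex.I * l);
        star (1 / (((1 + t : ℝ) : ℂ) + Complex.I * l)), ((1 / (1 + t) : ℝ) : ℂ)] -
        (Matrix.of fun i j => N i j / (1 + t * N i j) : Mat 2)).PosSemidef := fun t ht => by
    have h1 := hψ.2.2 t ht
    rw [resolvent_phaseMatrix l ht] at h1
    rw [hS, resolvent_schurMap (hden t ht)] at h1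
    rw [← isCP_schurMap_iff]
    convert h1 using 1
    refine LinearMap.ext fun A => ?_
    ext i j
    rw [LinearMap.sub_apply, Matrix.sub_apply, schurMap_apply, schurMap_apply, schurMap_apply,
      Matrix.sub_apply, sub_mul]
  have hre : ∀ q : ℝ, ∀ t : ℝ, ((q : ℂ) / (1 + t * q)).re = q / (1 + t * q) := fun q t => by
    have : ((q : ℂ) / (1 + t * q)) = ((q / (1 + t * q) : ℝ) : ℂ) := by push_cast; rfl
    rw [this, Complex.ofReal_re]
  have hd0 := hdt 0 le_rfl
  have hp1 := (Complex.nonneg_iff.mp (hd0.diag_nonneg (i := 0))).1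
  have hr1 := (Complex.nonneg_iff.mp (hd0.diag_nonneg (i := 1))).1
  simp at hp1 hr1
  have hres := schur_parameters (p := (N 0 0).re) (r := (N 1 1).re) (l := l) (w := N 0 1) hp hr
    hp1 hr1 (fun t ht => hden t ht 0 1)
    (fun t ht => by
      have h1 := (hψt t ht).normSq_le 0 1
      simp only [Matrix.of_apply] at h1
      rwa [hpN, hrN, hre, hre] at h1)
    (fun t ht => by
      have h1 := (hdt t ht).normSq_le 0 1
      simp only [Matrix.of_apply, Matrix.sub_apply, Matrix.cons_val_zero, Matrix.cons_val_one,
        Matrix.cons_val', Matrix.cons_val_fin_one, Complex.sub_re, Complex.ofReal_re] at h1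
      rwa [hpN, hrN, hre, hre] at h1)
  have h10 : N 1 0 = star (N 0 1) := (hcp.isHermitian.apply 1 0).symm
  rcases hres with ⟨h1, h2, h3⟩ | ⟨s, hs, h1, h2, h3⟩
  · left
    rw [hS]
    refine LinearMap.ext fun A => ?_
    ext i j
    rw [schurMap_apply]
    have : N i j = 0 := by
      fin_cases i <;> fin_cases j
      · change N 0 0 = 0; rw [hpN, h1]; simp
      · exact h3
      · change N 1 0 = 0; rw [h10, h3]; simp
      · change N 1 1 = 0; rw [hrN, h2]; simp
    rw [this, zero_mul]; rfl
  · right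
    refine ⟨s, hs, ?_⟩
    rw [resolvent_phaseMatrix l hs, hS]
    congr 1
    ext i j
    fin_cases i <;> fin_cases j
    · change N 0 0 = _; rw [hpN, h1]; rfl
    · exact h3
    · change N 1 0 = _; rw [h10, h3]; rfl
    · change N 1 1 = _; rw [hrN, h2]; rfl

/-! ### Maps between diagonal matrices -/

/-- The map that reads off the diagonal, applies `C`, and returns a diagonal matrix. -/
def diagMap (C : Mat n) : Map n where
  toFun A := Matrix.diagonal (C *ᵥ A.diag)
  map_add' A B := by
    rw [Matrix.diag_add, Matrix.mulVec_add, Matrix.diagonal_add]; rfl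
  map_smul' c A := by
    rw [Matrix.diag_smul, Matrix.mulVec_smul, Matrix.diagonal_smul]; rfl

lemma diagMap_apply (C A : Mat n) : diagMap C A = Matrix.diagonal (C *ᵥ A.diag) := rfl

lemma diagMap_mul (C D : Mat n) : diagMap C * diagMap D = diagMap (C * D) := by
  refine LinearMap.ext fun A => ?_
  simp only [Module.End.mul_apply, diagMap_apply, Matrix.diag_diagonal, Matrix.mulVec_mulVec]

lemma diagMap_add (C D : Mat n) : diagMap (C + D) = diagMap C + diagMap D := by
  refine LinearMap.ext fun A => ?_
  rw [LinearMap.add_apply, diagMap_apply, diagMap_apply, diagMap_apply, Matrix.add_mulVec,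
    Matrix.diagonal_add]
  rfl

lemma diagMap_sub (C D : Mat n) : diagMap (C - D) = diagMap C - diagMap D := by
  rw [eq_sub_iff_add_eq, ← diagMap_add, sub_add_cancel]

lemma diagMap_smul (c : ℂ) (C : Mat n) : diagMap (c • C) = c • diagMap C := by
  refine LinearMap.ext fun A => ?_
  simp only [LinearMap.smul_apply, diagMap_apply, Matrix.smul_mulVec, Matrix.diagonal_smul]

lemma isCP_diagMap {C : Mat n} (h : ∀ i j, 0 ≤ C i j) : IsCP (diagMap C) := by
  rw [isCP_iff]
  have : choi (diagMap C) = Matrix.diagonal fun x : Fin n × Fin n => C x.2 x.1 := by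
    ext ⟨i, k⟩ ⟨j, l⟩
    rw [choi_apply, diagMap_apply, Matrix.diagonal_apply, Matrix.diagonal_apply]
    simp only [Matrix.mulVec, dotProduct, Matrix.diag_apply, Matrix.single_apply]
    by_cases h1 : k = l
    · subst h1
      by_cases h2 : i = j
      · subst h2; simp
      · have : ∀ x : Fin n, ¬ (i = x ∧ j = x) := fun x hx => h2 (hx.1.trans hx.2.symm)
        simp [this, h2]
    · simp [h1]
  rw [this, Matrix.posSemidef_diagonal_iff]
  exact fun x => h _ _

lemma resolvent_diagMap {C D : Mat n} {t : ℝ} (hu : IsUnit (1 + (t : ℂ) • diagMap C))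
    (h : D + (t : ℂ) • (D * C) = C) : resolvent (diagMap C) t = diagMap D := by
  refine resolvent_eq_of_mul hu ?_
  rw [mul_add, mul_one, mul_smul_comm, diagMap_mul, ← diagMap_smul, ← diagMap_add, h]

lemma not_isQPure_diagMap {a b : ℝ} (ha : 0 ≤ a) (hb : 0 ≤ b) (hab : a + b ≠ 1) :
    ¬ IsQPure (diagMap !![1 - (a : ℂ), (a : ℂ); (b : ℂ), 1 - (b : ℂ)]) := by
  intro h
  rw [isQPure_iff] at h
  obtain ⟨hq, h⟩ := h
  set C : Mat 2 := !![1 - (a : ℂ), (a : ℂ); (b : ℂ), 1 - (b : ℂ)] with hC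
  obtain ⟨m, hm⟩ : ∃ m : ℝ, m = 1 - a - b := ⟨_, rfl⟩
  -- `m` is an eigenvalue with eigenvector `diag(a, -b)`, so it is not negative; `hab` excludes
  -- zero.
  have hm0 : 0 < m := by
    by_contra hneg
    have hm' : m < 0 := lt_of_le_of_ne (not_lt.mp hneg) fun h0 => hab (by linarith)
    refine hq.1 m hm' (Module.End.hasEigenvalue_of_hasEigenvector
      (x := Matrix.diagonal ![(a : ℂ), -(b : ℂ)]) ⟨Module.End.mem_eigenspace_iff.mpr ?_, ?_⟩)
    · rw [diagMap_apply, Matrix.diag_diagonal, ← Matrix.diagonal_smul]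
      congr 1
      ext i
      fin_cases i <;> simp [hC, Matrix.mulVec, dotProduct, Fin.sum_univ_two, hm] <;> ring
    · intro h0
      have h1 := congrFun (congrFun h0 0) 0
      have h2 := congrFun (congrFun h0 1) 1
      simp at h1 h2
      rw [h1, h2] at hm
      linarith
  have ha1 : 0 < 1 - a := by linarith
  -- `m` is the determinant of `C`, and `d` is the reciprocal of the lower right entry of `C⁻¹`.
  obtain ⟨d, hd⟩ : ∃ d : ℝ, d = m / (1 - a) := ⟨_, rfl⟩
  have hd0 : 0 < d := by rw [hd]; positivity
  set D : Mat 2 := !![0, 0; 0, (d : ℂ)] with hD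
  have hDD : diagMap D * diagMap D = (d : ℂ) • diagMap D := by
    rw [diagMap_mul, ← diagMap_smul]
    congr 1
    ext i j
    fin_cases i <;> fin_cases j <;> simp [hD]
  have hDcp : IsCP (diagMap D) := isCP_diagMap fun i j => by
    fin_cases i <;> fin_cases j <;> simp [hD, hd0.le]
  have hdom : QDominates (diagMap C) (diagMap D) := by
    refine ⟨hq, isQPositive_of_mul_self hd0.le hDD hDcp, fun t ht => ?_⟩
    have hΔ : 0 < (1 + t) * (1 + t * m) := by positivity
    have hres : resolvent (diagMap C) t = diagMap (((1 / ((1 + t) * (1 + t * m)) : ℝ) : ℂ) •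
        !![((1 - a + t * m : ℝ) : ℂ), (a : ℂ); (b : ℂ), ((1 - b + t * m : ℝ) : ℂ)]) := by
      refine resolvent_diagMap (hq.isUnit ht) ?_
      have h1 : ((1 : ℂ) + t) * (1 + t * m) ≠ 0 := by exact_mod_cast hΔ.ne'
      have h2 : (1 : ℂ) + t ≠ 0 := left_ne_zero_of_mul h1
      have h3 : (1 : ℂ) + t * m ≠ 0 := right_ne_zero_of_mul h1
      have hm' : (m : ℂ) = 1 - a - b := by rw [hm]; push_cast; ring
      ext i j
      fin_cases i <;> fin_cases j <;>
        simp [hC] <;> field_simp <;> rw [hm'] <;> ring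
    rw [hres, (isUnit_and_resolvent_of_mul_self hd0.le hDD ht).2, ← diagMap_smul, ← diagMap_sub]
    -- After cross-multiplication the two sides differ by exactly `ab`.
    have hkey : 1 / (1 + t * d) * d ≤ 1 / ((1 + t) * (1 + t * m)) * (1 - b + t * m) := by
      have h1 : 1 / (1 + t * d) * d = m / (1 - a + t * m) := by
        rw [hd]; field_simp
      rw [h1, one_div_mul_eq_div, div_le_div_iff₀ (by positivity) hΔ, hm]
      nlinarith [mul_nonneg ha hb]
    have hb1 : 0 ≤ 1 - b := by linarith
    refine isCP_diagMap fun i j => ?_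
    fin_cases i <;> fin_cases j
    iterate 3
      · simp only [hD, Matrix.sub_apply, Matrix.smul_apply, smul_eq_mul, Matrix.of_apply,
          Fin.zero_eta, Fin.mk_one, Matrix.cons_val_zero, Matrix.cons_val_one, Matrix.cons_val',
          Matrix.cons_val_fin_one, mul_zero, sub_zero]
        rw [← Complex.ofReal_mul, Complex.zero_le_real]
        positivity
    · simp only [hD, Matrix.sub_apply, Matrix.smul_apply, smul_eq_mul, Matrix.of_apply,
        Fin.mk_one, Matrix.cons_val_one, Matrix.cons_val', Matrix.cons_val_fin_one]
      rw [← Complex.ofReal_mul, ← Complex.ofReal_mul, ← Complex.ofReal_sub, Complex.zero_le_real,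
        sub_nonneg]
      exact hkey
  have hone : diagMap C 1 = 1 := by
    rw [diagMap_apply, ← Matrix.diagonal_one]
    congr 1
    ext i
    fin_cases i <;> simp [hC, Matrix.mulVec, dotProduct, Fin.sum_univ_two]
  rcases h _ hdom with h0 | ⟨s, hs, h0⟩
  · have h1 := congrFun (congrFun (LinearMap.congr_fun h0 1) 1) 1
    simp [diagMap_apply, hD, dotProduct, hd0.ne'] at h1
  · have h1 := congrFun (congrFun (LinearMap.congr_fun h0 1) 0) 0
    rw [resolvent_apply_one hq hone hs] at h1
    simp [diagMap_apply, hD, dotProduct] at h1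
    have h2 : (1 : ℂ) + s ≠ 0 := by exact_mod_cast (by positivity : (0 : ℝ) < 1 + s).ne'
    exact h2 h1.symm

/-! ### Maps whose range contains a non-scalar matrix -/

/-- The limit idempotent `L` fixes the range of `φ`, hence both diagonal matrix units, and so is a
Schur map with off-diagonal multiplier `0` or `1`. If `1`, `L` is the identity and `ker φ ⊆ ker L`
is trivial; if `0`, `φ = φL = Lφ` gives the other alternative. -/
lemma bijective_or_diagonal {φ : Map 2} (h : IsQPositive φ) (h1 : φ 1 = 1) {A : Mat 2}
    {d : Fin 2 → ℂ} (hA : φ A = Matrix.diagonal d) (hd : d 0 ≠ d 1) :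
    Function.Bijective φ ∨ (φ (Matrix.single 0 1 1) = 0 ∧ φ (Matrix.single 1 0 1) = 0 ∧
      ∀ B, φ B 0 1 = 0 ∧ φ B 1 0 = 0) := by
  obtain ⟨L, hL, hLφ, hφL, hker, -⟩ := h.exists_limit fun t ht =>
    QDominates.one_sub_posSemidef (φ := φ) (by
      simpa [resolvent_zero_right] using h.qDominates_resolvent le_rfl) h1 ht
  have hL1 : L 1 = 1 := by rw [← h1, ← Module.End.mul_apply, hLφ]
  have hLd : L (Matrix.diagonal d) = Matrix.diagonal d := by
    rw [← hA, ← Module.End.mul_apply, hLφ]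
  have hd' : d 0 - d 1 ≠ 0 := sub_ne_zero.mpr hd
  have hs0 : Matrix.single 0 0 (1 : ℂ) =
      (d 0 - d 1)⁻¹ • (Matrix.diagonal d - d 1 • (1 : Mat 2)) := by
    ext i j
    fin_cases i <;> fin_cases j <;> simp [hd']
  have hs1 : Matrix.single 1 1 (1 : ℂ) = (1 : Mat 2) - Matrix.single 0 0 1 := by
    ext i j
    fin_cases i <;> fin_cases j <;> simp
  have hL00 : L (Matrix.single 0 0 1) = Matrix.single 0 0 1 := by
    rw [hs0, map_smul, map_sub, map_smul, hLd, hL1]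
  have hL11 : L (Matrix.single 1 1 1) = Matrix.single 1 1 1 := by
    rw [hs1, map_sub, hL00, hL1]
  have hS := hL.eq_schurMap (by
    intro i k hik
    rw [choi_apply]
    fin_cases i <;> fin_cases k
    · exact absurd rfl hik
    · change L (Matrix.single 0 0 1) 1 1 = 0
      rw [hL00]; simp
    · change L (Matrix.single 1 1 1) 0 0 = 0
      rw [hL11]; simp
    · exact absurd rfl hik)
  set N : Mat 2 := Matrix.of fun i j => L (Matrix.single i j 1) i j with hN
  have hN00 : N 0 0 = 1 := by
    change L (Matrix.single 0 0 1) 0 0 = 1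
    rw [hL00]; simp
  have hN11 : N 1 1 = 1 := by
    change L (Matrix.single 1 1 1) 1 1 = 1
    rw [hL11]; simp
  have hNpos : N.PosSemidef := by rwa [hS, isCP_schurMap_iff] at hL
  have hN10 : N 1 0 = star (N 0 1) := (hNpos.isHermitian.apply 1 0).symm
  have hLL : L (L (Matrix.single 0 1 1)) = L (Matrix.single 0 1 1) := by
    have h2 : L (L (Matrix.single 0 1 1) - Matrix.single 0 1 1) = 0 := hker _ (by
      rw [map_sub, ← Module.End.mul_apply, hφL, sub_self])
    rwa [map_sub, sub_eq_zero] at h2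
  have hx : N 0 1 = 0 ∨ N 0 1 = 1 := by
    have h2 := congrFun (congrFun hLL 0) 1
    rw [hS, schurMap_apply, schurMap_apply] at h2
    simp only [Matrix.single_apply, and_self, if_true, mul_one] at h2
    have h3 : N 0 1 * (N 0 1 - 1) = 0 := by linear_combination h2
    rcases mul_eq_zero.mp h3 with h4 | h4
    · exact Or.inl h4
    · exact Or.inr (sub_eq_zero.mp h4)
  rcases hx with hx | hx
  · right
    have hz01 : L (Matrix.single 0 1 1) = 0 := by
      rw [hS]
      ext i j
      rw [schurMap_apply]
      fin_cases i <;> fin_cases j <;> simp [hx]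
    have hz10 : L (Matrix.single 1 0 1) = 0 := by
      rw [hS]
      ext i j
      rw [schurMap_apply]
      fin_cases i <;> fin_cases j <;> simp [hN10, hx]
    refine ⟨?_, ?_, fun B => ?_⟩
    · rw [← hφL, Module.End.mul_apply, hz01, map_zero]
    · rw [← hφL, Module.End.mul_apply, hz10, map_zero]
    · rw [← hLφ, Module.End.mul_apply, hS, schurMap_apply, schurMap_apply, hN10, hx]
      simp
  · left
    have hLid : ∀ B, L B = B := fun B => by
      rw [hS]
      ext i j
      rw [schurMap_apply]
      have : N i j = 1 := by
        fin_cases i <;> fin_cases j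
        · exact hN00
        · exact hx
        · change N 1 0 = 1; rw [hN10, hx]; simp
        · exact hN11
      rw [this, one_mul]
    have hinj : Function.Injective φ := by
      rw [injective_iff_map_eq_zero]
      intro B hB
      rw [← hLid B, hker B hB]
    exact ⟨hinj, LinearMap.injective_iff_surjective.mp hinj⟩

lemma IsQPure.bijective_of_diagonal {φ : Map 2} (h : IsQPure φ) (h1 : φ 1 = 1) {A : Mat 2}
    {d : Fin 2 → ℂ} (hA : φ A = Matrix.diagonal d) (hd : d 0 ≠ d 1) : Function.Bijective φ := by
  refine (bijective_or_diagonal h.1 h1 hA hd).resolve_right ?_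
  rintro ⟨h01, h10, hoff⟩
  have hcp := h.1.2 0 le_rfl
  rw [resolvent_zero_right] at hcp
  obtain ⟨hb, hbi⟩ := Complex.nonneg_iff.mp
    (hcp.choi_posSemidef.diag_nonneg (i := ((0 : Fin 2), (1 : Fin 2))))
  obtain ⟨ha, hai⟩ := Complex.nonneg_iff.mp
    (hcp.choi_posSemidef.diag_nonneg (i := ((1 : Fin 2), (0 : Fin 2))))
  rw [choi_apply] at ha hb hai hbi
  dsimp only at ha hb hai hbi
  set a := (φ (Matrix.single 1 1 1) 0 0).re with had
  set b := (φ (Matrix.single 0 0 1) 1 1).re with hbd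
  have haC : φ (Matrix.single 1 1 1) 0 0 = (a : ℂ) := by
    apply Complex.ext <;> simp [← hai, had]
  have hbC : φ (Matrix.single 0 0 1) 1 1 = (b : ℂ) := by
    apply Complex.ext <;> simp [← hbi, hbd]
  have hsum : φ (Matrix.single 0 0 1) + φ (Matrix.single 1 1 1) = 1 := by
    rw [← map_add, ← h1]
    congr 1
    ext i j
    fin_cases i <;> fin_cases j <;> simp
  have ha' : φ (Matrix.single 0 0 1) 0 0 = 1 - (a : ℂ) := by
    have h2 := congrFun (congrFun hsum 0) 0
    rw [Matrix.add_apply, haC, Matrix.one_apply_eq] at h2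
    linear_combination h2
  have hb' : φ (Matrix.single 1 1 1) 1 1 = 1 - (b : ℂ) := by
    have h2 := congrFun (congrFun hsum 1) 1
    rw [Matrix.add_apply, hbC, Matrix.one_apply_eq] at h2
    linear_combination h2
  have hφ : φ = diagMap !![1 - (a : ℂ), (a : ℂ); (b : ℂ), 1 - (b : ℂ)] := by
    refine LinearMap.ext fun B => ?_
    rw [map_eq_sum φ B]
    simp only [Fin.sum_univ_two, h01, h10, smul_zero, add_zero, zero_add]
    ext i j
    rw [Matrix.add_apply, Matrix.smul_apply, Matrix.smul_apply, smul_eq_mul, smul_eq_mul,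
      diagMap_apply]
    fin_cases i <;> fin_cases j
    · change B 0 0 * φ (Matrix.single 0 0 1) 0 0 + B 1 1 * φ (Matrix.single 1 1 1) 0 0 = _
      rw [ha', haC]
      simp [dotProduct, Fin.sum_univ_two]
      ring
    · change B 0 0 * φ (Matrix.single 0 0 1) 0 1 + B 1 1 * φ (Matrix.single 1 1 1) 0 1 = _
      rw [(hoff _).1, (hoff _).1]
      simp
    · change B 0 0 * φ (Matrix.single 0 0 1) 1 0 + B 1 1 * φ (Matrix.single 1 1 1) 1 0 = _
      rw [(hoff _).2, (hoff _).2]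
      simp
    · change B 0 0 * φ (Matrix.single 0 0 1) 1 1 + B 1 1 * φ (Matrix.single 1 1 1) 1 1 = _
      rw [hb', hbC]
      simp [dotProduct, Fin.sum_univ_two]
      ring
  -- If `a + b = 1` the stochastic matrix has equal rows, so every value of `φ` is scalar, contrary
  -- to `d 0 ≠ d 1`.
  refine not_isQPure_diagMap ha hb (fun hab => hd ?_) (hφ ▸ h)
  rw [hφ, diagMap_apply] at hA
  have h2 := congrFun (congrFun hA 0) 0
  have h3 := congrFun (congrFun hA 1) 1
  have hab' : (a : ℂ) + b = 1 := by exact_mod_cast hab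
  simp [dotProduct, Fin.sum_univ_two] at h2 h3
  rw [← h2, ← h3]
  linear_combination (A 1 1 - A 0 0) * hab'

lemma exists_unitaryConj_diagonal {H : Mat n} (hH : H.IsHermitian) :
    ∃ (U : Matrix.unitaryGroup (Fin n) ℂ) (d : Fin n → ℝ),
      (unitaryConj U : Map n) H = Matrix.diagonal fun i => (d i : ℂ) := by
  refine ⟨hH.eigenvectorUnitary, hH.eigenvalues, ?_⟩
  have h1 := hH.conjStarAlgAut_star_eigenvectorUnitary
  rw [unitaryConj_apply]
  rw [Unitary.conjStarAlgAut_star_apply] at h1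
  exact h1

/-- A non-scalar value can be taken at a Hermitian argument, hence Hermitian itself; a unitary
conjugation then reduces to a diagonal value. -/
lemma IsQPure.scalar_or_bijective {φ : Map 2} (h : IsQPure φ) (h1 : φ 1 = 1) :
    (∀ A, ∃ c : ℂ, φ A = c • (1 : Mat 2)) ∨ Function.Bijective φ := by
  by_cases hsc : ∀ A, star A = A → ∃ c : ℂ, φ A = c • (1 : Mat 2)
  · left
    intro A
    obtain ⟨c, hc⟩ := hsc (A + star A) (by rw [star_add, star_star, add_comm])
    obtain ⟨c', hc'⟩ := hsc (Complex.I • (A - star A)) (by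
      rw [star_smul, star_sub, star_star, RCLike.star_def, Complex.conj_I, neg_smul, ← smul_neg,
        neg_sub])
    refine ⟨(1 / 2) * (c - Complex.I * c'), ?_⟩
    have h2 : A = (1 / 2 : ℂ) • ((A + star A) - Complex.I • (Complex.I • (A - star A))) := by
      rw [smul_smul, Complex.I_mul_I]
      module
    conv_lhs => rw [h2]
    rw [map_smul, map_sub, map_smul, hc, hc', smul_smul, ← sub_smul, smul_smul]
  · right
    push Not at hsc
    obtain ⟨A, hA, hns⟩ := hsc
    have hcp := h.1.2 0 le_rfl
    rw [resolvent_zero_right] at hcp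
    have hH : (φ A).IsHermitian := by
      have := hcp.map_star A
      rw [hA] at this
      exact this.symm
    obtain ⟨U, d, hd⟩ := exists_unitaryConj_diagonal hH
    have hq := h.conj (isCP_unitaryConj U) (isCP_unitaryConj_inv U)
    have hb := hq.bijective_of_diagonal (unitaryConj_map_one U h1)
      (A := (unitaryConj U : Map 2) A) (d := fun i => (d i : ℂ)) (by
        rw [← hd, Module.End.mul_apply, Module.End.mul_apply, ← Module.End.mul_apply _ _ A,
          Units.inv_mul, Module.End.one_apply]) (by
        intro h0
        apply hns (d 0 : ℂ)
        have h2 : (unitaryConj U : Map 2) (φ A) = (d 0 : ℂ) • (1 : Mat 2) := by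
          rw [hd, ← Matrix.diagonal_one, ← Matrix.diagonal_smul]
          congr 1
          ext i
          fin_cases i
          · simp
          · simpa using h0.symm
        have h3 := congrArg (↑(unitaryConj U)⁻¹ : Map 2) h2
        rw [← Module.End.mul_apply, Units.inv_mul, Module.End.one_apply, map_smul] at h3
        rw [h3, unitaryConj_inv_apply, mul_one,
          show (U : Mat 2) * star (U : Mat 2) = 1 from Unitary.coe_mul_star_self U])
    rw [← Module.End.isUnit_iff] at hb ⊢
    have h4 := ((unitaryConj U)⁻¹.isUnit.mul hb).mul (unitaryConj U).isUnit
    simpa [mul_assoc] using h4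

/-! ### Lyapunov maps -/

/-- The map `A ↦ Y A + A Y*`. -/
def lyapunov (Y : Mat n) : Map n where
  toFun A := Y * A + A * star Y
  map_add' A B := by rw [mul_add, add_mul]; abel
  map_smul' c A := by rw [mul_smul_comm, smul_mul_assoc, smul_add]; rfl

lemma lyapunov_apply (Y A : Mat n) : lyapunov Y A = Y * A + A * star Y := rfl

lemma lyapunov_star (Y A : Mat n) : lyapunov Y (star A) = star (lyapunov Y A) := by
  simp only [lyapunov_apply, star_add, star_mul, star_star, add_comm]

/-- On an eigenvector `v` of `X` with eigenvalue `x`, the form of `ZX + XZᴴ` is `x` times the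
positive form of `Z + Zᴴ`. -/
lemma _root_.Matrix.IsHermitian.posSemidef_of_lyapunov {ι : Type*} [Fintype ι] [DecidableEq ι]
    {X Z : Matrix ι ι ℂ} (hX : X.IsHermitian) (hZ : (Z + Zᴴ).PosDef)
    (h : (Z * X + X * Zᴴ).PosSemidef) : X.PosSemidef := by
  rw [hX.posSemidef_iff_eigenvalues_nonneg]
  intro i
  set v : ι → ℂ := (hX.eigenvectorBasis i).ofLp with hv
  have hXv : X *ᵥ v = (hX.eigenvalues i : ℂ) • v := by
    have := hX.mulVec_eigenvectorBasis i
    rw [this]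
    ext j
    simp [hv]
  have hv0 : v ≠ 0 := by
    intro h0
    have h1 := hX.eigenvectorBasis.orthonormal.ne_zero i
    apply h1
    ext j
    exact congrFun h0 j
  have hvX : star v ᵥ* X = (hX.eigenvalues i : ℂ) • star v := by
    have h1 := congrArg star hXv
    rw [Matrix.star_mulVec, hX.eq] at h1
    rw [h1]
    ext j
    simp
  have h1 := h.dotProduct_mulVec_nonneg v
  have h2 := hZ.dotProduct_mulVec_pos hv0
  have h3 : star v ⬝ᵥ ((Z * X + X * Zᴴ) *ᵥ v) =
      (hX.eigenvalues i : ℂ) * (star v ⬝ᵥ ((Z + Zᴴ) *ᵥ v)) := by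
    rw [Matrix.add_mulVec, ← Matrix.mulVec_mulVec, ← Matrix.mulVec_mulVec, hXv,
      Matrix.mulVec_smul, dotProduct_add, dotProduct_smul, Matrix.dotProduct_mulVec _ X, hvX,
      smul_dotProduct, Matrix.add_mulVec, dotProduct_add, smul_eq_mul, smul_eq_mul, mul_add]
  rw [h3] at h1
  have h4 : (0 : ℂ) ≤ (hX.eigenvalues i : ℂ) := by
    by_contra hneg
    obtain ⟨h5, h6⟩ := Complex.pos_iff.mp h2
    have h7 := (Complex.nonneg_iff.mp h1).1
    rw [Complex.re_ofReal_mul] at h7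
    exact hneg (Complex.zero_le_real.mpr (nonneg_of_mul_nonneg_left h7 h5))
  exact Complex.zero_le_real.mp h4

lemma eq_zero_of_posSemidef_of_neg {ι : Type*} [Fintype ι] [DecidableEq ι] {X : Matrix ι ι ℂ}
    (h : X.PosSemidef) (h' : (-X).PosSemidef) : X = 0 := by
  rw [← h.trace_eq_zero_iff]
  have h1 := h'.trace_nonneg
  rw [Matrix.trace_neg] at h1
  exact le_antisymm (neg_nonneg.mp h1) h.trace_nonneg

lemma isUnit_lyapunov {Y : Mat n} (hY : (Y + star Y).PosDef) : IsUnit (lyapunov Y) := by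
  have hherm : ∀ X : Mat n, star X = X → lyapunov Y X = 0 → X = 0 := by
    intro X hX h0
    have hX' : X.IsHermitian := hX
    -- A Hermitian kernel element satisfies the Lyapunov criterion with both signs.
    refine eq_zero_of_posSemidef_of_neg (hX'.posSemidef_of_lyapunov hY ?_)
      (hX'.neg.posSemidef_of_lyapunov hY ?_)
    · have : Y * X + X * Yᴴ = 0 := h0
      rw [this]
      exact Matrix.PosSemidef.zero
    · have : Y * -X + -X * Yᴴ = 0 := by
        have h1 : Y * X + X * Yᴴ = 0 := h0
        rw [mul_neg, neg_mul, ← neg_add, h1, neg_zero]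
      rw [this]
      exact Matrix.PosSemidef.zero
  have hinj : Function.Injective (lyapunov Y) := by
    rw [injective_iff_map_eq_zero]
    intro X hX
    have hX' : lyapunov Y (star X) = 0 := by rw [lyapunov_star, hX, star_zero]
    have h1 := hherm (X + star X) (by rw [star_add, star_star, add_comm])
      (by rw [map_add, hX, hX', add_zero])
    have h2 := hherm (Complex.I • (X - star X)) (by
      rw [star_smul, star_sub, star_star, RCLike.star_def, Complex.conj_I, neg_smul, ← smul_neg,
        neg_sub]) (by rw [map_smul, map_sub, hX, hX', sub_zero, smul_zero])
    have h3 := (smul_eq_zero.mp h2).resolve_left Complex.I_ne_zero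
    have h4 : X = (1 / 2 : ℂ) • ((X + star X) + (X - star X)) := by module
    rw [h4, h1, h3, add_zero, smul_zero]
  exact (Module.End.isUnit_iff _).mpr ⟨hinj, LinearMap.injective_iff_surjective.mp hinj⟩

lemma isHermitian_choi {θ : Map n} (h : ∀ A, θ (star A) = star (θ A)) :
    (choi θ).IsHermitian := by
  ext x y
  rw [Matrix.conjTranspose_apply, choi_apply, choi_apply, ← Matrix.star_apply, ← h]
  rw [Matrix.star_eq_conjTranspose, Matrix.conjTranspose_single, star_one]

-- The Choi matrix of the inverse solves a Lyapunov equation with coefficient `1 ⊗ Y` and right side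
-- the Choi matrix of the identity, which is positive.
open scoped Kronecker in
lemma isCP_inverse_lyapunov {Y : Mat n} (hY : (Y + star Y).PosDef) :
    IsCP (Ring.inverse (lyapunov Y)) := by
  have hu := isUnit_lyapunov hY
  have hinj := ((Module.End.isUnit_iff _).mp hu).1
  have hmul := Ring.mul_inverse_cancel _ hu
  set θ := Ring.inverse (lyapunov Y) with hθ
  have hstar : ∀ A, θ (star A) = star (θ A) := fun A => by
    apply hinj
    rw [lyapunov_star, ← Module.End.mul_apply, ← Module.End.mul_apply, hmul]
    rfl
  rw [isCP_iff]
  have hone : (1 : Mat n).PosDef := Matrix.PosDef.one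
  refine (isHermitian_choi hstar).posSemidef_of_lyapunov (Z := (1 : Mat n) ⊗ₖ Y) ?_ ?_
  · have h1 : (1 : Mat n) ⊗ₖ Y + ((1 : Mat n) ⊗ₖ Y)ᴴ = (1 : Mat n) ⊗ₖ (Y + star Y) := by
      rw [Matrix.conjTranspose_kronecker, Matrix.conjTranspose_one, ← Matrix.kronecker_add,
        Matrix.star_eq_conjTranspose]
    rw [h1]
    exact hone.kronecker hY
  · have h1 : (1 : Mat n) ⊗ₖ Y * choi θ + choi θ * ((1 : Mat n) ⊗ₖ Y)ᴴ =
        choi (lyapunov Y * θ) := by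
      ext ⟨i, k⟩ ⟨j, l⟩
      rw [choi_apply, Module.End.mul_apply, lyapunov_apply, Matrix.add_apply, Matrix.add_apply,
        Matrix.mul_apply, Matrix.mul_apply, Matrix.mul_apply, Matrix.mul_apply,
        Fintype.sum_prod_type, Fintype.sum_prod_type]
      simp [Matrix.one_apply, choi_apply, apply_ite]
    rw [h1, hmul]
    exact IsCP.choi_posSemidef (fun k A hA => hA)

/-- The unnormalized maximally entangled vector. -/
def omega : Fin n × Fin n → ℂ := fun x => if x.1 = x.2 then 1 else 0

lemma star_omega : star (omega : Fin n × Fin n → ℂ) = omega := by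
  ext x
  simp [omega, apply_ite]

lemma choi_one : choi (1 : Map n) = Matrix.vecMulVec omega omega := by
  ext x y
  rw [choi_apply, Matrix.vecMulVec_apply, Module.End.one_apply, Matrix.single_apply]
  by_cases h1 : x.1 = x.2 <;> by_cases h2 : y.1 = y.2 <;> simp [h1, h2, omega]

lemma choi_lyapunov (Y : Mat n) : choi (lyapunov Y) =
    Matrix.vecMulVec (fun x => Y x.2 x.1) omega +
      Matrix.vecMulVec omega (star fun x => Y x.2 x.1) := by
  ext ⟨i, k⟩ ⟨j, l⟩
  rw [choi_apply, lyapunov_apply, Matrix.add_apply, Matrix.add_apply, Matrix.vecMulVec_apply,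
    Matrix.vecMulVec_apply]
  congr 1
  · by_cases h : j = l
    · subst h; simp [omega]
    · simp [omega, h, Matrix.mul_apply]
  · by_cases h : i = k
    · subst h; simp [omega]
    · simp [omega, h, Ne.symm h]

lemma omega_dotProduct_omega : (omega : Fin 2 × Fin 2 → ℂ) ⬝ᵥ omega = 2 := by
  simp only [dotProduct, Fintype.sum_prod_type, Fin.sum_univ_two, omega]
  norm_num

/-- The projection onto the orthogonal complement of `omega`. -/
def omegaCompl : Matrix (Fin 2 × Fin 2) (Fin 2 × Fin 2) ℂ :=
  1 - (1 / 2 : ℂ) • Matrix.vecMulVec omega omega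

lemma omegaCompl_mul_omega : omegaCompl * Matrix.vecMulVec omega omega = 0 := by
  rw [omegaCompl, sub_mul, one_mul, smul_mul_assoc, Matrix.vecMulVec_mul_vecMulVec,
    omega_dotProduct_omega, Matrix.vecMulVec_smul, smul_smul]
  norm_num

lemma omega_mul_omegaCompl : Matrix.vecMulVec omega omega * omegaCompl = 0 := by
  rw [omegaCompl, mul_sub, mul_one, mul_smul_comm, Matrix.vecMulVec_mul_vecMulVec,
    omega_dotProduct_omega, Matrix.vecMulVec_smul, smul_smul]
  norm_num

lemma conjTranspose_omegaCompl : omegaComplᴴ = omegaCompl := by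
  rw [omegaCompl, Matrix.conjTranspose_sub, Matrix.conjTranspose_one, Matrix.conjTranspose_smul,
    Matrix.conjTranspose_vecMulVec, star_omega]
  simp

/-- A Hermitian matrix differs from its compression by the Choi matrix of a Lyapunov map. -/
lemma exists_lyapunov {C : Matrix (Fin 2 × Fin 2) (Fin 2 × Fin 2) ℂ} (hC : C.IsHermitian) :
    ∃ Y : Mat 2, choi (lyapunov Y) = C - omegaCompl * C * omegaCompl := by
  obtain ⟨c, hc⟩ : ∃ c : ℂ, c = omega ⬝ᵥ (C *ᵥ omega) := ⟨_, rfl⟩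
  have hvC : omega ᵥ* C = star (C *ᵥ omega) := by
    rw [Matrix.star_mulVec, star_omega, hC.eq]
  have hcs : star c = c := by
    rw [Matrix.dotProduct_mulVec, hvC] at hc
    rw [hc, ← Matrix.star_dotProduct_star, star_star, star_omega, dotProduct_comm, ← hvC,
      ← Matrix.dotProduct_mulVec, dotProduct_comm]
  -- `omegaCompl` is `1 - ½ωω*`; the expansion has a term `-(c/4)ωω*`, split evenly between the two
  -- adjoint summands, whence `1/8`.
  refine ⟨Matrix.of fun k i => (1 / 2) * (C *ᵥ omega) (i, k) - (1 / 8) * c * omega (i, k), ?_⟩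
  rw [choi_lyapunov]
  have h1 : omegaCompl * C * omegaCompl = C -
      (1 / 2 : ℂ) • Matrix.vecMulVec omega (star (C *ᵥ omega)) -
      (1 / 2 : ℂ) • Matrix.vecMulVec (C *ᵥ omega) omega +
      (c / 4) • Matrix.vecMulVec omega omega := by
    rw [omegaCompl, sub_mul, one_mul, smul_mul_assoc, Matrix.vecMulVec_mul, hvC, mul_sub, mul_one,
      sub_mul, mul_smul_comm, Matrix.mul_vecMulVec, smul_mul_assoc, mul_smul_comm,
      Matrix.vecMulVec_mul_vecMulVec, ← hvC, ← Matrix.dotProduct_mulVec, ← hc,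
      Matrix.vecMulVec_smul]
    module
  rw [h1]
  ext ⟨i, k⟩ ⟨j, l⟩
  have ho : ∀ x : Fin 2 × Fin 2, star (omega x) = omega x := fun x => congrFun star_omega x
  simp only [Matrix.add_apply, Matrix.sub_apply, Matrix.smul_apply, Matrix.vecMulVec_apply,
    Matrix.of_apply, Pi.star_apply, smul_eq_mul, star_sub, star_mul', hcs, ho]
  have h2 : star (1 / 2 : ℂ) = 1 / 2 := by simp
  have h8 : star (1 / 8 : ℂ) = 1 / 8 := by simp
  rw [h2, h8]
  ring

/-! ### Invertible unital maps -/

lemma tendsto_resolvent_apply {φ : Map n} (h : IsQPositive φ) (h1 : φ 1 = 1) (A : Mat n)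
    (i j : Fin n) : Tendsto (fun t : ℝ => resolvent φ t A i j) atTop (𝓝 0) := by
  have h2 := tendsto_map_apply (l := atTop) (θ := fun t : ℝ => resolvent φ t) (L := 0)
    (fun x y => ?_) A i j
  · simpa using h2
  · rw [choi_zero, Matrix.zero_apply]
    have h3 : Tendsto (fun t : ℝ => 1 / (1 + t)) atTop (𝓝 0) :=
      tendsto_const_nhds.div_atTop (tendsto_atTop_add_const_left _ _ tendsto_id)
    refine squeeze_zero_norm' ?_ h3
    filter_upwards [eventually_ge_atTop 0] with t ht
    refine (h.2 t ht).norm_choi_le (by positivity) ?_ x y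
    rw [resolvent_apply_one h h1 ht, sub_self]
    exact Matrix.PosSemidef.zero

/-- The inverse of a `q`-positive unital map is conditionally negative. -/
lemma compression_posSemidef {φ T : Map 2} (h : IsQPositive φ) (h1 : φ 1 = 1) (hT : φ * T = 1)
    (hT' : T * φ = 1) : (omegaCompl * choi (-T) * omegaCompl).PosSemidef := by
  have hlim : ∀ x y, Tendsto (fun t : ℝ => choi (resolvent φ t * (T * T)) x y) atTop (𝓝 0) :=
    fun x y => tendsto_resolvent_apply h h1 _ _ _
  refine posSemidef_of_tendsto (l := atTop)
    (f := fun t : ℝ => ((t ^ 2 : ℝ) : ℂ) • (omegaCompl * choi (resolvent φ t) * omegaCompl)) ?_ ?_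
  · filter_upwards [eventually_ge_atTop 0] with t ht
    have h2 := (h.2 t ht).choi_posSemidef.mul_mul_conjTranspose_same omegaCompl
    rw [conjTranspose_omegaCompl] at h2
    exact h2.smul (by rw [Complex.zero_le_real]; positivity)
  · intro x y
    have h2 : Tendsto (fun t : ℝ => (omegaCompl * choi (-T) * omegaCompl) x y +
        (omegaCompl * choi (resolvent φ t * (T * T)) * omegaCompl) x y) atTop
        (𝓝 ((omegaCompl * choi (-T) * omegaCompl) x y + 0)) := by
      refine tendsto_const_nhds.add ?_
      simp only [Matrix.mul_apply]
      have h3 : (0 : ℂ) = ∑ j, (∑ k, omegaCompl x k * 0) * omegaCompl j y := by simp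
      rw [h3]
      exact tendsto_finsetSum _ fun j _ => Tendsto.mul (tendsto_finsetSum _ fun k _ =>
        tendsto_const_nhds.mul (hlim k j)) tendsto_const_nhds
    rw [add_zero] at h2
    refine h2.congr' ?_
    filter_upwards [eventually_ge_atTop 0] with t ht
    have h3 := (resolvent_mul_inverse_add hT hT' (h.isUnit ht)).1
    rw [mul_add, mul_smul_comm, mul_one] at h3
    -- Second-order expansion of `(T + t)⁻¹` at infinity. Compression removes the divergent term `t
    -- • 1`, and the remainder tends to zero.
    have h4 : ((t ^ 2 : ℝ) : ℂ) • resolvent φ t =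
        -T + resolvent φ t * (T * T) + (t : ℂ) • 1 := by
      have h5 : resolvent φ t * T = 1 - (t : ℂ) • resolvent φ t := eq_sub_of_add_eq h3
      rw [← mul_assoc, h5, sub_mul, one_mul, smul_mul_assoc, h5, smul_sub, smul_smul]
      push_cast
      rw [sq]
      abel
    rw [← Matrix.add_apply, ← add_mul, ← mul_add, ← choi_add]
    rw [← smul_mul_assoc, ← mul_smul_comm, ← choi_smul, h4, choi_add _ ((t : ℂ) • 1), choi_smul,
      choi_one, mul_add, mul_smul_comm, omegaCompl_mul_omega, smul_zero, add_zero]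

/-- The inverse of a unital invertible `q`-pure map is a Lyapunov map. -/
lemma IsQPure.exists_lyapunov {φ T : Map 2} (h : IsQPure φ) (h1 : φ 1 = 1) (hT : φ * T = 1)
    (hT' : T * φ = 1) : ∃ Y : Mat 2, Y + star Y = 1 ∧ T = lyapunov Y := by
  rw [isQPure_iff] at h
  obtain ⟨hq, hsub⟩ := h
  have hcp := hq.2 0 le_rfl
  rw [resolvent_zero_right] at hcp
  have hT1 : T 1 = 1 := by
    conv_lhs => rw [← h1]
    rw [← Module.End.mul_apply, hT', Module.End.one_apply]
  have hTstar : ∀ A, T (star A) = star (T A) := fun A => by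
    have h2 : φ (star (T A)) = star A := by
      rw [hcp.map_star, ← Module.End.mul_apply, hT, Module.End.one_apply]
    rw [← h2, ← Module.End.mul_apply, hT', Module.End.one_apply]
  obtain ⟨Y, hY⟩ := QPos.exists_lyapunov (isHermitian_choi hTstar)
  have hS := compression_posSemidef hq h1 hT hT'
  rw [← choi_ofChoi (omegaCompl * choi (-T) * omegaCompl), ← isCP_iff] at hS
  have hScomp := choi_ofChoi (omegaCompl * choi (-T) * omegaCompl)
  set S : Map 2 := ofChoi (omegaCompl * choi (-T) * omegaCompl) with hSdef
  have hTS : lyapunov Y = T + S := by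
    apply choi_injective
    rw [hY, choi_add, hScomp, choi_neg, mul_neg, neg_mul, sub_eq_add_neg]
  have hlyt : ∀ t : ℝ, lyapunov (Y + ((t / 2 : ℝ) : ℂ) • 1) = lyapunov Y + (t : ℂ) • 1 := by
    intro t
    refine LinearMap.ext fun A => ?_
    rw [LinearMap.add_apply, LinearMap.smul_apply, lyapunov_apply, lyapunov_apply,
      Module.End.one_apply, star_add, star_smul, star_one, RCLike.star_def, Complex.conj_ofReal,
      add_mul, mul_add, smul_mul_assoc, mul_smul_comm, one_mul, mul_one]
    push_cast
    module
  -- The matrix is the shifted Lyapunov map evaluated at `1`, namely `1 + S 1 + t`.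
  have hpd : ∀ t : ℝ, 0 ≤ t →
      (Y + ((t / 2 : ℝ) : ℂ) • 1 + star (Y + ((t / 2 : ℝ) : ℂ) • 1)).PosDef := by
    intro t ht
    have h2 : Y + ((t / 2 : ℝ) : ℂ) • 1 + star (Y + ((t / 2 : ℝ) : ℂ) • 1) =
        (1 : Mat 2) + (S 1 + (t : ℂ) • 1) := by
      have h3 := LinearMap.congr_fun (hlyt t) 1
      rw [lyapunov_apply, mul_one, one_mul] at h3
      rw [h3, LinearMap.add_apply, hTS, LinearMap.add_apply, hT1, add_assoc]
      rfl
    rw [h2]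
    exact Matrix.PosDef.one.add_posSemidef ((hS.posSemidef Matrix.PosSemidef.one).add
      (Matrix.PosSemidef.one.smul (by exact_mod_cast ht)))
  have hunit : ∀ t : ℝ, 0 ≤ t → IsUnit (lyapunov Y + (t : ℂ) • 1) := fun t ht =>
    hlyt t ▸ isUnit_lyapunov (hpd t ht)
  obtain ⟨hψq, hψres⟩ := isQPositive_of_inverse (T := lyapunov Y)
    (θ := fun t : ℝ => Ring.inverse (lyapunov Y + (t : ℂ) • 1))
    (fun t ht => hlyt t ▸ isCP_inverse_lyapunov (hpd t ht))
    (fun t ht => Ring.inverse_mul_cancel _ (hunit t ht))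
    (fun t ht => Ring.mul_inverse_cancel _ (hunit t ht))
  have h0u := hunit 0 le_rfl
  simp only [Complex.ofReal_zero, zero_smul, add_zero] at h0u hψq hψres
  have hdom : QDominates φ (Ring.inverse (lyapunov Y)) := by
    refine ⟨hq, hψq, fun t ht => ?_⟩
    rw [hψres t ht]
    have h2 := (resolvent_mul_inverse_add hT hT' (hq.isUnit ht)).1
    have h3 := Ring.mul_inverse_cancel _ (hunit t ht)
    have hψt : IsCP (Ring.inverse (lyapunov Y + (t : ℂ) • 1)) := by
      have := hψq.2 t ht
      rwa [hψres t ht] at this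
    -- Second resolvent identity: the two inverses differ by `S`, so the difference is a product of
    -- completely positive maps.
    have h4 : resolvent φ t - Ring.inverse (lyapunov Y + (t : ℂ) • 1) =
        resolvent φ t * S * Ring.inverse (lyapunov Y + (t : ℂ) • 1) := by
      have h5 : S = (lyapunov Y + (t : ℂ) • 1) - (T + (t : ℂ) • 1) := by
        rw [hTS]; abel
      rw [h5, mul_sub, sub_mul, h2, one_mul, mul_assoc, h3, mul_one]
    rw [h4]
    exact ((hq.2 t ht).mul hS).mul hψt
  -- Purity makes `S` a multiple `s • 1`, with Choi matrix `s ωω*`; but the Choi matrix of `S` is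
  -- annihilated by `ωω*`, so `s = 0`.
  have hS0 : S = 0 := by
    rcases hsub _ hdom with h2 | ⟨s, hs, h2⟩
    · have h3 := Ring.mul_inverse_cancel _ h0u
      rw [h2, mul_zero] at h3
      exact absurd h3 zero_ne_one
    · have h3 := Ring.mul_inverse_cancel _ h0u
      have h4 := (resolvent_mul_inverse_add hT hT' (hq.isUnit hs)).1
      rw [← h2] at h4
      have h5 : lyapunov Y = T + (s : ℂ) • 1 := by
        calc lyapunov Y = lyapunov Y * (Ring.inverse (lyapunov Y) * (T + (s : ℂ) • 1)) := by
              rw [h4, mul_one]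
          _ = T + (s : ℂ) • 1 := by rw [← mul_assoc, h3, one_mul]
      have h6 : S = (s : ℂ) • 1 := by
        rw [hTS] at h5
        exact add_left_cancel h5
      have h7 : Matrix.vecMulVec omega omega * choi S = 0 := by
        rw [hScomp, mul_assoc, ← mul_assoc, omega_mul_omegaCompl, zero_mul]
      rw [h6, choi_smul, choi_one, mul_smul_comm, Matrix.vecMulVec_mul_vecMulVec,
        omega_dotProduct_omega] at h7
      have h8 := congrFun (congrFun h7 (0, 0)) (0, 0)
      simp [Matrix.vecMulVec_apply, omega] at h8
      rw [h6, h8]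
      simp
  refine ⟨Y, ?_, ?_⟩
  · have h2 := LinearMap.congr_fun hTS 1
    rwa [hS0, add_zero, hT1, lyapunov_apply, mul_one, one_mul] at h2
  · rw [hTS, hS0, add_zero]

lemma lyapunov_conj (U : Matrix.unitaryGroup (Fin n) ℂ) (Y : Mat n) :
    (unitaryConj U : Map n) * lyapunov Y * (↑(unitaryConj U)⁻¹ : Map n) =
      lyapunov ((unitaryConj U : Map n) Y) := by
  refine LinearMap.ext fun A => ?_
  have h2 : star (U : Mat n) * U = 1 := Unitary.coe_star_mul_self U
  rw [Module.End.mul_apply, Module.End.mul_apply, unitaryConj_inv_apply, lyapunov_apply,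
    lyapunov_apply, unitaryConj_apply, unitaryConj_apply, star_mul, star_mul, star_star, mul_add,
    add_mul]
  congr 1
  · calc _ = star (U : Mat n) * Y * U * A * (star (U : Mat n) * U) := by simp only [mul_assoc]
      _ = _ := by rw [h2, mul_one]
  · calc _ = (star (U : Mat n) * U) * A * (star (U : Mat n) * (star Y * U)) := by
          simp only [mul_assoc]
      _ = _ := by rw [h2, one_mul]

lemma unitaryConj_star (U : Matrix.unitaryGroup (Fin n) ℂ) :
    unitaryConj (star U) = (unitaryConj U)⁻¹ := Units.ext rfl

lemma IsQPure.isConjugateTo_phaseMatrix {φ : Map 2} (h : IsQPure φ) (h1 : φ 1 = 1)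
    (hb : Function.Bijective φ) : ∃ l : ℝ, IsConjugateTo φ (schurMap (phaseMatrix l)) := by
  have hu := (Module.End.isUnit_iff _).mpr hb
  have hm := Ring.mul_inverse_cancel _ hu
  have hm' := Ring.inverse_mul_cancel _ hu
  obtain ⟨Y, hY, hT⟩ := h.exists_lyapunov h1 hm hm'
  rw [hT] at hm hm'
  have hH : ((-Complex.I) • (Y - (1 / 2 : ℂ) • 1)).IsHermitian := by
    have h2 : star Y = 1 - Y := eq_sub_of_add_eq' hY
    change star _ = _
    rw [star_smul, star_sub, star_smul, star_one, h2, RCLike.star_def, map_neg,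
      Complex.conj_I, neg_neg, map_div₀, map_one, map_ofNat]
    module
  obtain ⟨U, d, hd⟩ := exists_unitaryConj_diagonal hH
  have hd' : (unitaryConj U : Map 2) Y =
      (1 / 2 : ℂ) • 1 + Complex.I • Matrix.diagonal fun i => (d i : ℂ) := by
    have h3 : (unitaryConj U : Map 2) 1 = 1 := by
      rw [unitaryConj_apply, mul_one]; exact Unitary.coe_star_mul_self U
    rw [← hd, map_smul, map_sub, map_smul, h3, smul_smul, mul_neg, Complex.I_mul_I]
    module
  -- With `Y = 1/2 + i diag(d)`, the Lyapunov map multiplies entry `(j, k)` by `1 + i(d j - d k)`.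
  -- Since `U` diagonalizes `Y`, `φ` is recovered by conjugating back with `star U`.
  refine ⟨d 0 - d 1, isConjugateTo_iff.mpr ⟨star U, ?_⟩⟩
  have hschur : schurMap (phaseMatrix (d 0 - d 1)) * lyapunov ((unitaryConj U : Map 2) Y) = 1 := by
    refine LinearMap.ext fun A => ?_
    have h2 := one_add_I_mul_ne_zero 1 (d 0 - d 1) one_pos
    have h3 := one_add_I_mul_ne_zero 1 (-(d 0 - d 1)) one_pos
    push_cast at h2 h3
    rw [mul_neg, ← sub_eq_add_neg] at h3
    rw [hd', Module.End.mul_apply, Module.End.one_apply, lyapunov_apply]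
    ext i j
    rw [schurMap_apply]
    fin_cases i <;> fin_cases j <;>
      simp [phaseMatrix, Matrix.mul_apply, Fin.sum_univ_two, Matrix.star_apply]
    · ring
    · field_simp
      ring
    · field_simp
      ring
    · ring
  rw [← lyapunov_conj] at hschur
  rw [unitaryConj_star, inv_inv]
  have h4 := congrArg (fun x => (↑(unitaryConj U)⁻¹ : Map 2) * x * (unitaryConj U : Map 2) * φ)
    hschur
  simp only [mul_one, Units.inv_mul, one_mul] at h4
  rw [← h4]
  simp only [mul_assoc]
  rw [← mul_assoc (↑(unitaryConj U)⁻¹ : Map 2) (unitaryConj U : Map 2) φ, Units.inv_mul, one_mul,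
    hm', mul_one]

end QPos

end

theorem mainTheorem1 (φ : QPos.Map 2) (hφ : φ 1 = 1) :
    (QPos.IsQPure φ ↔
      (∃ ρ : QPos.Mat 2 →ₗ[ℂ] ℂ, QPos.IsFaithfulState ρ ∧
        ∀ A : QPos.Mat 2, φ A = ρ A • (1 : QPos.Mat 2)) ∨
      (∃ l : ℝ, QPos.IsConjugateTo φ
        (QPos.schurMap
          !![1, 1 / (1 + Complex.I * (l : ℂ)); 1 / (1 - Complex.I * (l : ℂ)), 1]))) ∧
    (QPos.IsQPure φ →
      Module.finrank ℂ (LinearMap.range φ) = 1 ∨ Function.Bijective φ) := by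
  have hscalar : (∀ A, ∃ c : ℂ, φ A = c • (1 : QPos.Mat 2)) →
      ∃ ρ : QPos.Mat 2 →ₗ[ℂ] ℂ, ρ 1 = 1 ∧ φ = ρ.smulRight 1 := by
    intro h
    refine ⟨Matrix.entryLinearMap ℂ ℂ 0 0 ∘ₗ φ, by simp [hφ], LinearMap.ext fun A => ?_⟩
    obtain ⟨c, hc⟩ := h A
    simp [hc]
  refine ⟨⟨fun h => ?_, ?_⟩, fun h => ?_⟩
  · rcases h.scalar_or_bijective hφ with hs | hb
    · obtain ⟨ρ, hρ, rfl⟩ := hscalar hs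
      exact Or.inl ⟨ρ, h.faithful_of_smulRight hρ, fun A => rfl⟩
    · exact Or.inr (h.isConjugateTo_phaseMatrix hφ hb)
  · rintro (⟨ρ, hρ, h⟩ | ⟨l, hl⟩)
    · have : φ = ρ.smulRight 1 := LinearMap.ext h
      rw [this]
      exact QPos.isQPure_smulRight_of_faithful hρ
    · obtain ⟨U, hU⟩ := QPos.isConjugateTo_iff.mp hl
      rw [hU]
      exact (QPos.isQPure_phaseMatrix l).conj (QPos.isCP_unitaryConj U)
        (QPos.isCP_unitaryConj_inv U)
  · refine (h.scalar_or_bijective hφ).imp_left fun hs => ?_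
    have hr : LinearMap.range φ = Submodule.span ℂ {(1 : QPos.Mat 2)} := by
      apply le_antisymm
      · rintro _ ⟨A, rfl⟩
        obtain ⟨c, hc⟩ := hs A
        exact Submodule.mem_span_singleton.mpr ⟨c, hc.symm⟩
      · rw [Submodule.span_singleton_le_iff_mem]
        exact ⟨1, hφ⟩
    rw [hr]
    exact finrank_span_singleton one_ne_zero
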